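/- **Theorem (Moment bounds with constant stepsize).** Let $f:\mathbb{R}^d\to\mathbb{R}$ be differentiable with global minimizer $\theta^*$, and suppose: 1. (Smoothness) there is $L>0$ with $\|\nabla f(\theta)-\nabla f(\theta')\|\le L\|\theta-\theta'\|$ for all $\theta,\theta'\in\mathbb{R}^d$. 2. (Local strong convexity and sub-quadratic tail) there are $\mu,a,b,\Delta>0$ and $k\in[1,2)$ such that $\langle\theta'-\theta'',\nabla f(\theta')-\nabla f(\theta'')\rangle\ge\mu\|\theta'-\theta''\|^2$ whenever $\|\theta'-\theta^*\|\le\Delta$ and $\|\theta''-\theta^*\|\le\Delta$, and, whenever $\|\theta-\theta^*\|>\Delta$, $\|\nabla f(\theta)\|\le a\|\theta-\theta^*\|^{k-1}$ and $\langle\theta-\theta^*,\nabla f(\theta)\rangle\ge b\|\theta-\theta^*\|^k$. 3. (Noise) $w_0,w_1,\dots$ are i.i.d. copies of a random field $w$ on $\mathbb{R}^d$ with values in $\mathbb{R}^d$, i.e. $w_n(\theta)=W(\theta,\xi_n)$ with $W$ jointly measurable and $\xi_0,\xi_1,\dots$ i.i.d. random elements of a measurable space; $\mathbb{E}[w(\theta)]=0$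 for all $\theta$, and $\|w(\theta)\|$ is uniformly in the $\psi_{2-k}$-Orlicz space: there is $K>0$ with $\mathbb{P}(\|w(\theta)\|\ge t)\le 2\exp(-t^{2-k}/K^{2-k})$ for all $t\ge0$ and $\theta\in\mathbb{R}^d$. For $\alpha>0$ and $\theta_0\in\mathbb{R}^d$ let $\theta_{n+1}=\theta_n-\alpha(\nabla f(\theta_n)+w_n(\theta_n))$ for $n\ge0$. Define $$V_{k,0}(\theta)=\begin{cases}\exp\Big(\frac{k\|\theta-\theta^*\|^{2-k}}{(2-k)\Delta^{2-k}}\Big)-(1-\tfrac k2)\exp\big(\tfrac{k}{2-k}\big),&\|\theta-\theta^*\|>\Delta,\\[2mm] \frac{k\exp(k/(2-k))\|\theta-\theta^*\|^2}{2\Delta^2},&\|\theta-\theta^*\|\le\Delta,\end{cases}$$ and, for every integer $p\ge0$, $V_{k,2p}(\theta)=\|\theta-\theta^*\|^{2p}V_{k,0}(\theta)$ and $\mu_{k,2p}=\min\big(\tfrac{bk}{2\Delta^{2-k}},\,\mu(1+p)\big)$. Then for every integer $p\ge0$ there exist $\bar\alpha_{k,p}>0$ and a constant $d_{k,2p}$,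 neither depending on $\alpha$, $\theta_0$ or $n$, such that for all $\theta_0\in\mathbb{R}^d$, all $0<\alpha\le\bar\alpha_{k,p}$ and all integers $n\ge0$ with $n\ge\frac{-p\ln\alpha}{\alpha\mu_{k,0}}$, the moment $\mathbb{E}\|\theta_n-\theta^*\|^{2p+2}$ is finite and $$\mathbb{E}\|\theta_n-\theta^*\|^{2p+2}\le\frac{2\Delta^2V_{k,2p}(\theta_0)}{k\exp(k/(2-k))}(1-\alpha\mu_{k,2p})^n+\alpha^{p+1}d_{k,2p}.$$ -/

import Mathlib

noncomputable section

/-- `d`-dimensional Euclidean space. -/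
abbrev Rd (d : ℕ) : Type := EuclideanSpace ℝ (Fin d)

/-- Smoothness: `f` is differentiable and its gradient is `L`-Lipschitz, `L > 0`. -/
structure SmoothObjective {d : ℕ} (f : Rd d → ℝ) (L : ℝ) : Prop where
  L_pos : 0 < L
  differentiable : Differentiable ℝ f
  lipschitz_gradient : ∀ θ θ' : Rd d, ‖gradient f θ - gradient f θ'‖ ≤ L * ‖θ - θ'‖

/-- Local strong convexity in the ball of radius `Δ` about `θstar` and sub-quadratic tail of
order `k ∈ [1, 2)` outside it. -/
structure SubquadraticTail {d : ℕ} (f : Rd d → ℝ) (θstar : Rd d) (μ a b Δ k : ℝ) : Prop where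
  μ_pos : 0 < μ
  a_pos : 0 < a
  b_pos : 0 < b
  Δ_pos : 0 < Δ
  one_le_k : 1 ≤ k
  k_lt_two : k < 2
  strong_convexity : ∀ θ' θ'' : Rd d, ‖θ' - θstar‖ ≤ Δ → ‖θ'' - θstar‖ ≤ Δ →
    μ * ‖θ' - θ''‖ ^ 2 ≤ inner ℝ (θ' - θ'') (gradient f θ' - gradient f θ'')
  gradient_growth : ∀ θ : Rd d, Δ < ‖θ - θstar‖ →
    ‖gradient f θ‖ ≤ a * ‖θ - θstar‖ ^ (k - 1)
  gradient_inner : ∀ θ : Rd d, Δ < ‖θ - θstar‖ →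
    b * ‖θ - θstar‖ ^ k ≤ inner ℝ (θ - θstar) (gradient f θ)

/-- The real random variable `X` lies in the `ψ_q`-Orlicz space with tail parameter `K`:
`ℙ(|X| ≥ t) ≤ 2 exp(-t^q / K^q)` for all `t ≥ 0`. -/
def OrliczTail {Ω : Type*} [MeasurableSpace Ω] (P : MeasureTheory.Measure Ω)
    (q K : ℝ) (X : Ω → ℝ) : Prop :=
  0 < K ∧ ∀ t : ℝ, 0 ≤ t → P.real {ω | t ≤ |X ω|} ≤ 2 * Real.exp (-(t ^ q / K ^ q))

/-- The fields `θ ↦ W θ (ξ n)`, `n = 0, 1, …`, are i.i.d. copies of a (jointly measurable) random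
field with mean zero at every point: `W` is a fixed measurable function and the `ξ n` are i.i.d.
random elements of a measurable space `S`. -/
structure IIDCenteredField {d : ℕ} {Ω S : Type*} [MeasurableSpace Ω] [MeasurableSpace S]
    (P : MeasureTheory.Measure Ω) (W : Rd d → S → Rd d) (ξ : ℕ → Ω → S) : Prop where
  measurable_field : Measurable (Function.uncurry W)
  measurable_seed : ∀ n, Measurable (ξ n)
  indep : ProbabilityTheory.iIndepFun ξ P
  ident : ∀ n, ProbabilityTheory.IdentDistrib (ξ n) (ξ 0) P P
  centered : ∀ θ : Rd d, ∫ ω, W θ (ξ 0 ω) ∂P = 0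

/-- SGD with constant stepsize `α` and initial point `θ₀`:
`θ_{n+1} = θ_n - α (∇f(θ_n) + w_n(θ_n))`, where `w_n(θ) = W θ (ξ n)`. -/
def sgd {d : ℕ} {Ω S : Type*} (f : Rd d → ℝ) (W : Rd d → S → Rd d) (ξ : ℕ → Ω → S)
    (α : ℝ) (θ₀ : Rd d) : ℕ → Ω → Rd d
  | 0, _ => θ₀
  | n + 1, ω =>
      sgd f W ξ α θ₀ n ω -
        α • (gradient f (sgd f W ξ α θ₀ n ω) + W (sgd f W ξ α θ₀ n ω) (ξ n ω))

/-- The piecewise Lyapunov function `V_{k,0}`. -/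
def lyapunovZero {d : ℕ} (k Δ : ℝ) (θstar θ : Rd d) : ℝ :=
  if ‖θ - θstar‖ ≤ Δ then
    k * Real.exp (k / (2 - k)) * ‖θ - θstar‖ ^ 2 / (2 * Δ ^ 2)
  else
    Real.exp (k * ‖θ - θstar‖ ^ (2 - k) / ((2 - k) * Δ ^ (2 - k)))
      - (1 - k / 2) * Real.exp (k / (2 - k))

/-- `V_{k,m}(θ) = ‖θ - θstar‖ ^ m * V_{k,0}(θ)`. -/
def lyapunov {d : ℕ} (k Δ : ℝ) (m : ℕ) (θstar θ : Rd d) : ℝ :=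
  ‖θ - θstar‖ ^ m * lyapunovZero k Δ θstar θ

/-- The rate `μ_{k,2p} = min (b k / (2 Δ^{2-k})) (μ (1 + p))`. -/
def rateTwo (k b Δ μ : ℝ) (p : ℕ) : ℝ :=
  min (b * k / (2 * Δ ^ (2 - k))) (μ * (1 + p))

end

open Real MeasureTheory ProbabilityTheory

/-! Write `q = 1 - k/2`, `s = (‖θ - θ*‖ / Δ)²`. Up to a constant factor the Lyapunov function is `s
^ p * profile q s`, which is `s ^ (p + 1)` in the ball and grows like an exponential of `‖θ - θ*‖ ^
(2 - k)` outside. Outside the ball the drift is too weak to contract a power of the distance by a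
fixed factor, but it lowers `‖θ - θ*‖ ^ (2 - k)` by a fixed amount of order `α`, hence contracts the
exponential.

A step of SGD is split into a gradient step and a noise step. The gradient step contracts by `1 -
5/4 αρ`, where `ρ` is the rate (`exists_gradient_step_contraction`). For the noise step the Lyapunov
function is expanded to second order, which is possible because the two branches of `profile` match
up to the second derivative. The linear term has mean zero. Since `2 - k ≤ 1`, the exponential
weight of a sum is at most the product of the weights, so the noise factors out of the remainder,
and the Orlicz tail makes its expectation finite for small `α`
(`exists_lintegral_normalizedLyapunov_sub_le`). What is left, of order `α² (s ^ p + α ^ (2p))` times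
the weight, is absorbed by a quarter of the drift up to `D α ^ (p + 2)` (`exists_absorb`).

Hence `E V(θ_{n+1}) ≤ (1 - αρ) E V(θ_n) + D α ^ (p + 2)` (`exists_sgd_step_le`, with the Markov
property `lintegral_sgd_succ`). Iterating gives a geometric term plus `D α ^ (p + 1) / ρ`, and `s ≤
profile q s` turns this into a moment bound. -/

/-- The exponent-normalised radial profile of the Lyapunov function `V_{k,0}`, as a function of the
squared distance in units of `Δ`, where `k = 2 - 2 q`. -/
noncomputable def profile (q s : ℝ) : ℝ :=
  if s ≤ 1 then s else (exp ((1 - q) / q * (s ^ q - 1)) - q) / (1 - q)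

/-- The derivative of `profile`. -/
noncomputable def profileDeriv (q s : ℝ) : ℝ :=
  if s ≤ 1 then 1 else s ^ (q - 1) * exp ((1 - q) / q * (s ^ q - 1))

/-- The second derivative of `profile`. -/
noncomputable def profileDerivTwo (q s : ℝ) : ℝ :=
  if s ≤ 1 then 0
  else (1 - q) * (s ^ q - 1) * s⁻¹ * (s ^ (q - 1) * exp ((1 - q) / q * (s ^ q - 1)))

/-- The exponential weight dominating `profile` and its derivatives. -/
noncomputable def expWeight (q s : ℝ) : ℝ := exp ((1 - q) / q * s ^ q)

/-- Away from `c` only one branch is visible; at `c` the left and right derivatives agree, and the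
two closed half-lines cover the line. -/
theorem hasDerivAt_ite_le {f g : ℝ → ℝ} {f' g' : ℝ → ℝ} {c : ℝ}
    (hf : ∀ x, x ≤ c → HasDerivAt f (f' x) x) (hg : ∀ x, c ≤ x → HasDerivAt g (g' x) x)
    (hfg : f c = g c) (hfg' : f' c = g' c) (x : ℝ) :
    HasDerivAt (fun x => if x ≤ c then f x else g x) (if x ≤ c then f' x else g' x) x := by
  rcases lt_trichotomy x c with h | h | h
  · rw [if_pos h.le]
    refine (hf x h.le).congr_of_eventuallyEq ?_
    filter_upwards [Iio_mem_nhds h] with y hy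
    rw [if_pos (le_of_lt hy)]
  · subst h
    rw [if_pos le_rfl]
    have h1 : HasDerivWithinAt (fun y => if y ≤ x then f y else g y) (f' x) (Set.Iic x) x :=
      (hf x le_rfl).hasDerivWithinAt.congr (fun y hy => if_pos hy) (if_pos le_rfl)
    have h2 : HasDerivWithinAt (fun y => if y ≤ x then f y else g y) (f' x) (Set.Ici x) x := by
      rw [hfg']
      refine (hg x le_rfl).hasDerivWithinAt.congr (fun y hy => ?_) (by rw [if_pos le_rfl, hfg])
      rcases eq_or_lt_of_le (show x ≤ y from hy) with h | h
      · rw [← h, if_pos le_rfl, hfg]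
      · rw [if_neg (not_le.2 h)]
    have := h1.union h2
    rwa [Set.Iic_union_Ici, hasDerivWithinAt_univ] at this
  · rw [if_neg (not_le.2 h)]
    refine (hg x h.le).congr_of_eventuallyEq ?_
    filter_upwards [Ioi_mem_nhds h] with y hy
    rw [if_neg (not_le.2 hy)]

/-! ### Calculus of the radial profile and its exponential weight. -/

section Profile

variable {q : ℝ}

theorem hasDerivAt_exp_rpow (hq : 0 < q) {s : ℝ} (hs : 1 ≤ s) :
    HasDerivAt (fun s : ℝ => exp ((1 - q) / q * (s ^ q - 1)))
      ((1 - q) * (s ^ (q - 1) * exp ((1 - q) / q * (s ^ q - 1)))) s := by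
  have h0 : s ≠ 0 := by linarith
  have h := (((Real.hasDerivAt_rpow_const (p := q) (Or.inl h0)).sub_const 1).const_mul
    ((1 - q) / q)).exp
  convert h using 1
  field_simp

theorem hasDerivAt_profile (hq : 0 < q) (hq' : q ≤ 1 / 2) (s : ℝ) :
    HasDerivAt (profile q) (profileDeriv q s) s := by
  refine hasDerivAt_ite_le (f := fun x => x) (f' := fun _ => 1) (c := 1)
    (g := fun s => (exp ((1 - q) / q * (s ^ q - 1)) - q) / (1 - q))
    (g' := fun s => s ^ (q - 1) * exp ((1 - q) / q * (s ^ q - 1)))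
    (fun x _ => hasDerivAt_id x) (fun x hx => ?_) ?_ ?_ s
  · have h := ((hasDerivAt_exp_rpow hq hx).sub_const q).div_const (1 - q)
    have : 1 - q ≠ 0 := by linarith
    exact h.congr_deriv (by field_simp)
  · have : 1 - q ≠ 0 := by linarith
    simp [this]
  · simp

/-- The outer second derivative carries the factor `s ^ q - 1`, which vanishes at the joint, so a
Taylor expansion may cross the sphere of radius `Δ`. -/
theorem hasDerivAt_profileDeriv (hq : 0 < q) (s : ℝ) :
    HasDerivAt (profileDeriv q) (profileDerivTwo q s) s := by
  refine hasDerivAt_ite_le (f := fun _ => 1) (f' := fun _ => 0) (c := 1)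
    (g := fun s => s ^ (q - 1) * exp ((1 - q) / q * (s ^ q - 1)))
    (g' := fun s => (1 - q) * (s ^ q - 1) * s⁻¹ *
      (s ^ (q - 1) * exp ((1 - q) / q * (s ^ q - 1))))
    (fun x _ => hasDerivAt_const x (1 : ℝ)) (fun x hx => ?_) ?_ ?_ s
  · have h0 : x ≠ 0 := by linarith
    have h0' : 0 < x := by linarith
    have h := (Real.hasDerivAt_rpow_const (p := q - 1) (Or.inl h0)).mul (hasDerivAt_exp_rpow hq hx)
    refine h.congr_deriv ?_
    rw [Real.rpow_sub_one h0 (q - 1), Real.rpow_sub_one h0 q]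
    field_simp
    ring
  · simp
  · simp

theorem one_le_expWeight (hq : 0 < q) (hq' : q ≤ 1 / 2) {s : ℝ} (hs : 0 ≤ s) :
    1 ≤ expWeight q s := by
  refine Real.one_le_exp (mul_nonneg (div_nonneg (by linarith) hq.le) (Real.rpow_nonneg hs q))

theorem expWeight_pos (s : ℝ) : 0 < expWeight q s := Real.exp_pos _

theorem expWeight_mono (hq : 0 < q) (hq' : q ≤ 1 / 2) {s t : ℝ} (hs : 0 ≤ s) (hst : s ≤ t) :
    expWeight q s ≤ expWeight q t := by
  refine Real.exp_le_exp.2 (mul_le_mul_of_nonneg_left (Real.rpow_le_rpow hs hst hq.le)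
    (div_nonneg (by linarith) hq.le))

theorem exp_le_expWeight (hq : 0 < q) (hq' : q ≤ 1 / 2) (s : ℝ) :
    exp ((1 - q) / q * (s ^ q - 1)) ≤ expWeight q s := by
  refine Real.exp_le_exp.2 (mul_le_mul_of_nonneg_left (by linarith)
    (div_nonneg (by linarith) hq.le))

/-- Submultiplicativity of the exponential weight in the distance. -/
theorem expWeight_add_sq_le (hq : 0 < q) (hq' : q ≤ 1 / 2) {x y : ℝ} (hx : 0 ≤ x) (hy : 0 ≤ y) :
    expWeight q ((x + y) ^ 2) ≤ expWeight q (x ^ 2) * expWeight q (y ^ 2) := by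
  -- Subadditivity of `z ↦ z ^ (2 q)`, valid because `2 q ≤ 1`, that is `k ≥ 1`.
  have key : ((x + y) ^ 2) ^ q ≤ (x ^ 2) ^ q + (y ^ 2) ^ q := by
    have h : ∀ z : ℝ, 0 ≤ z → (z ^ 2) ^ q = z ^ (2 * q) := fun z hz => by
      rw [Real.rpow_mul hz]; norm_num
    rw [h _ (add_nonneg hx hy), h _ hx, h _ hy]
    exact Real.rpow_add_le_add_rpow hx hy (by linarith) (by linarith)
  unfold expWeight
  rw [← Real.exp_add, ← mul_add]
  exact Real.exp_le_exp.2 (mul_le_mul_of_nonneg_left key (div_nonneg (by linarith) hq.le))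

theorem profileDeriv_nonneg {s : ℝ} (hs : 0 ≤ s) : 0 ≤ profileDeriv q s := by
  unfold profileDeriv
  split_ifs
  · norm_num
  · positivity

theorem profileDeriv_le (hq : 0 < q) (hq' : q ≤ 1 / 2) {s : ℝ} (hs : 0 ≤ s) :
    profileDeriv q s ≤ expWeight q s := by
  unfold profileDeriv
  split_ifs with h
  · exact one_le_expWeight hq hq' hs
  · calc s ^ (q - 1) * exp ((1 - q) / q * (s ^ q - 1))
        ≤ 1 * exp ((1 - q) / q * (s ^ q - 1)) :=
          mul_le_mul_of_nonneg_right
            (Real.rpow_le_one_of_one_le_of_nonpos (by linarith) (by linarith)) (exp_pos _).le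
      _ ≤ _ := by rw [one_mul]; exact exp_le_expWeight hq hq' s

theorem profileDerivTwo_nonneg (hq : 0 < q) (hq' : q ≤ 1 / 2) (s : ℝ) :
    0 ≤ profileDerivTwo q s := by
  unfold profileDerivTwo
  split_ifs with h
  · exact le_rfl
  · have h1 : 1 ≤ s ^ q := Real.one_le_rpow (by linarith) hq.le
    have h2 : 0 ≤ s := by linarith
    have h3 : 0 ≤ 1 - q := by linarith
    have h4 : 0 ≤ s ^ q - 1 := by linarith
    positivity

/-- The algebraic factors combine to at most `s ^ (2 q - 1)`, which is at most `1` for `s > 1` since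
`q ≤ 1/2`. -/
theorem mul_profileDerivTwo_le (hq : 0 < q) (hq' : q ≤ 1 / 2) {s : ℝ} (hs : 0 ≤ s) :
    s * profileDerivTwo q s ≤ expWeight q s := by
  unfold profileDerivTwo
  split_ifs with h
  · rw [mul_zero]; exact (expWeight_pos s).le
  · have h0 : 0 < s := by linarith
    have h1 : 1 ≤ s ^ q := Real.one_le_rpow (by linarith) hq.le
    have h2 : (1 - q) * (s ^ q - 1) * s ^ (q - 1) ≤ 1 := by
      have h3 : s ^ q * s ^ (q - 1) ≤ 1 := by
        rw [← Real.rpow_add h0]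
        exact Real.rpow_le_one_of_one_le_of_nonpos (by linarith) (by linarith)
      have h4 : 0 ≤ s ^ (q - 1) := Real.rpow_nonneg hs _
      have h5 : (1 - q) * (s ^ q - 1) ≤ s ^ q := by nlinarith
      exact (mul_le_mul_of_nonneg_right h5 h4).trans h3
    calc s * ((1 - q) * (s ^ q - 1) * s⁻¹ * (s ^ (q - 1) * exp ((1 - q) / q * (s ^ q - 1))))
        = ((1 - q) * (s ^ q - 1) * s ^ (q - 1)) * exp ((1 - q) / q * (s ^ q - 1)) := by
          field_simp
      _ ≤ 1 * exp ((1 - q) / q * (s ^ q - 1)) :=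
          mul_le_mul_of_nonneg_right h2 (exp_pos _).le
      _ ≤ _ := by rw [one_mul]; exact exp_le_expWeight hq hq' s

theorem profileDerivTwo_le (hq : 0 < q) (hq' : q ≤ 1 / 2) {s : ℝ} (hs : 0 ≤ s) :
    profileDerivTwo q s ≤ expWeight q s := by
  by_cases h : s ≤ 1
  · rw [profileDerivTwo, if_pos h]; exact (expWeight_pos s).le
  · have := mul_profileDerivTwo_le hq hq' hs
    have h2 := profileDerivTwo_nonneg hq hq' s
    nlinarith

theorem profile_zero : profile q 0 = 0 := by simp [profile]

theorem profile_le (hq : 0 < q) (hq' : q ≤ 1 / 2) {s : ℝ} (hs : 0 ≤ s) :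
    profile q s ≤ s * expWeight q s := by
  rcases eq_or_lt_of_le hs with rfl | hs
  · simp [profile_zero]
  obtain ⟨c, hc, h⟩ := exists_hasDerivAt_eq_slope (profile q) (profileDeriv q) hs
    (fun x _ => (hasDerivAt_profile hq hq' x).continuousAt.continuousWithinAt)
    (fun x _ => hasDerivAt_profile hq hq' x)
  rw [profile_zero, sub_zero, sub_zero, eq_div_iff hs.ne'] at h
  rw [← h, mul_comm]
  exact mul_le_mul_of_nonneg_left ((profileDeriv_le hq hq' hc.1.le).trans
    (expWeight_mono hq hq' hc.1.le hc.2.le)) hs.le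

/-- The profile dominates the identity. -/
theorem le_profile (hq : 0 < q) (hq' : q ≤ 1 / 2) (s : ℝ) : s ≤ profile q s := by
  by_cases h : s ≤ 1
  · rw [profile, if_pos h]
  rw [not_le] at h
  obtain ⟨c, hc, h'⟩ := exists_hasDerivAt_eq_slope (profile q) (profileDeriv q) h
    (fun x _ => (hasDerivAt_profile hq hq' x).continuousAt.continuousWithinAt)
    (fun x _ => hasDerivAt_profile hq hq' x)
  -- Convexity: the slope is `1` at the joint and cannot decrease afterwards.
  obtain ⟨e, he, h''⟩ := exists_hasDerivAt_eq_slope (profileDeriv q) (profileDerivTwo q) hc.1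
    (fun x _ => (hasDerivAt_profileDeriv hq x).continuousAt.continuousWithinAt)
    (fun x _ => hasDerivAt_profileDeriv hq x)
  have h1 : profile q 1 = 1 := by simp [profile]
  have h2 : profileDeriv q 1 = 1 := by simp [profileDeriv]
  rw [eq_div_iff (by linarith [hc.1]), h2] at h''
  rw [eq_div_iff (by linarith), h1] at h'
  have := mul_nonneg (profileDerivTwo_nonneg hq hq' e) (sub_nonneg.2 hc.1.le)
  nlinarith

theorem profile_nonneg (hq : 0 < q) (hq' : q ≤ 1 / 2) {s : ℝ} (hs : 0 ≤ s) :
    0 ≤ profile q s := hs.trans (le_profile hq hq' s)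

/-- For `x ≥ 1` one has `x ≤ (x - q) / (1 - q)`. This converts the weight in the noise remainder
back into the Lyapunov function outside the ball. -/
theorem expWeight_le_profile (hq : 0 < q) (hq' : q ≤ 1 / 2) {s : ℝ} (hs : 1 < s) :
    expWeight q s ≤ exp ((1 - q) / q) * profile q s := by
  have h1 : 1 ≤ s ^ q := Real.one_le_rpow hs.le hq.le
  have h2 : 1 ≤ exp ((1 - q) / q * (s ^ q - 1)) :=
    Real.one_le_exp (mul_nonneg (div_nonneg (by linarith) hq.le) (by linarith))
  have h3 : expWeight q s = exp ((1 - q) / q) * exp ((1 - q) / q * (s ^ q - 1)) := by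
    rw [← exp_add, expWeight]; ring_nf
  rw [h3, profile, if_neg (not_le.2 hs)]
  refine mul_le_mul_of_nonneg_left ?_ (exp_pos _).le
  rw [le_div_iff₀ (by linarith)]
  nlinarith

/-- The derivative of `s ^ p * profile q s`. -/
noncomputable def weightedDeriv (q : ℝ) (p : ℕ) (s : ℝ) : ℝ :=
  p * s ^ (p - 1) * profile q s + s ^ p * profileDeriv q s

/-- The second derivative of `s ^ p * profile q s`. -/
noncomputable def weightedDerivTwo (q : ℝ) (p : ℕ) (s : ℝ) : ℝ :=
  p * ((p - 1 : ℕ) * s ^ (p - 1 - 1)) * profile q s + p * s ^ (p - 1) * profileDeriv q s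
    + (p * s ^ (p - 1) * profileDeriv q s + s ^ p * profileDerivTwo q s)

theorem hasDerivAt_weighted (hq : 0 < q) (hq' : q ≤ 1 / 2) (p : ℕ) (s : ℝ) :
    HasDerivAt (fun s => s ^ p * profile q s) (weightedDeriv q p s) s :=
  (hasDerivAt_pow p s).mul (hasDerivAt_profile hq hq' s)

theorem hasDerivAt_weightedDeriv (hq : 0 < q) (hq' : q ≤ 1 / 2) (p : ℕ) (s : ℝ) :
    HasDerivAt (weightedDeriv q p) (weightedDerivTwo q p s) s :=
  (((hasDerivAt_pow (p - 1) s).const_mul (p : ℝ)).mul (hasDerivAt_profile hq hq' s)).add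
    ((hasDerivAt_pow p s).mul (hasDerivAt_profileDeriv hq s))

theorem weightedDerivTwo_nonneg (hq : 0 < q) (hq' : q ≤ 1 / 2) (p : ℕ) {s : ℝ} (hs : 0 ≤ s) :
    0 ≤ weightedDerivTwo q p s := by
  have h1 := profile_nonneg hq hq' hs
  have h2 := profileDeriv_nonneg (q := q) hs
  have h3 := profileDerivTwo_nonneg hq hq' s
  unfold weightedDerivTwo
  positivity

theorem weightedDeriv_le (hq : 0 < q) (hq' : q ≤ 1 / 2) (p : ℕ) {s : ℝ} (hs : 0 ≤ s) :
    weightedDeriv q p s ≤ (p + 1) * (s ^ p * expWeight q s) := by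
  have h1 := profile_le hq hq' hs
  have h2 := profileDeriv_le hq hq' hs
  unfold weightedDeriv
  have h3 : p * s ^ (p - 1) * profile q s ≤ p * (s ^ p * expWeight q s) := by
    rcases p with _ | p
    · simp
    · calc _ ≤ ((p + 1 : ℕ) : ℝ) * s ^ (p + 1 - 1) * (s * expWeight q s) :=
            mul_le_mul_of_nonneg_left h1 (by positivity)
        _ = _ := by rw [Nat.add_sub_cancel]; ring
  have h4 := mul_le_mul_of_nonneg_left h2 (pow_nonneg hs p)
  linarith

theorem weightedDerivTwo_succ_le (hq : 0 < q) (hq' : q ≤ 1 / 2) (p : ℕ) {s : ℝ} (hs : 0 ≤ s) :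
    weightedDerivTwo q (p + 1) s ≤ (p + 2) ^ 2 * (s ^ p * expWeight q s) := by
  have h1 := profile_le hq hq' hs
  have h2 := profileDeriv_le hq hq' hs
  have h3 := mul_profileDerivTwo_le hq hq' hs
  have he := (expWeight_pos (q := q) s).le
  have hp := pow_nonneg hs p
  unfold weightedDerivTwo
  rw [Nat.add_sub_cancel]
  have h4 : ((p + 1 : ℕ) : ℝ) * (p * s ^ (p - 1)) * profile q s
      ≤ (p + 1) * p * (s ^ p * expWeight q s) := by
    rcases p with _ | p
    · simp
    · calc _ ≤ ((p + 1 + 1 : ℕ) : ℝ) * (((p + 1 : ℕ) : ℝ) * s ^ (p + 1 - 1)) *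
              (s * expWeight q s) :=
            mul_le_mul_of_nonneg_left h1 (by positivity)
        _ = _ := by rw [Nat.add_sub_cancel]; push_cast; ring
  have h5 : ((p + 1 : ℕ) : ℝ) * s ^ p * profileDeriv q s ≤ (p + 1) * (s ^ p * expWeight q s) := by
    rw [mul_assoc]; push_cast
    exact mul_le_mul_of_nonneg_left (mul_le_mul_of_nonneg_left h2 hp) (by positivity)
  have h6 : s ^ (p + 1) * profileDerivTwo q s ≤ s ^ p * expWeight q s := by
    rw [pow_succ, mul_assoc]
    exact mul_le_mul_of_nonneg_left h3 hp
  have h7 : 0 ≤ s ^ p * expWeight q s := by positivity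
  nlinarith

theorem mul_weightedDerivTwo_le (hq : 0 < q) (hq' : q ≤ 1 / 2) (p : ℕ) {s : ℝ} (hs : 0 ≤ s) :
    s * weightedDerivTwo q p s ≤ (p + 1) ^ 2 * (s ^ p * expWeight q s) := by
  rcases p with _ | p
  · have := mul_profileDerivTwo_le hq hq' hs
    simpa [weightedDerivTwo] using this
  · have := mul_le_mul_of_nonneg_left (weightedDerivTwo_succ_le hq hq' p hs) hs
    push_cast
    calc _ ≤ _ := this
      _ = _ := by ring

/-- Here `x` will be the size of the noise step. For positive powers, compare `x ^ 2` with `s` and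
replace the smaller by the larger; for `p = 0` the second derivative is bounded by the weight
itself. -/
theorem sq_mul_weightedDerivTwo_le (hq : 0 < q) (hq' : q ≤ 1 / 2) (p : ℕ) {s x : ℝ}
    (hs : 0 ≤ s) :
    x ^ 2 * weightedDerivTwo q p s
      ≤ (p + 1) ^ 2 * ((1 + x ^ 2) * (s ^ p + x ^ (2 * p)) * expWeight q s) := by
  have he := (expWeight_pos (q := q) s).le
  rcases p with _ | p
  · have h := mul_le_mul_of_nonneg_left (profileDerivTwo_le hq hq' hs) (sq_nonneg x)
    have h2 : weightedDerivTwo q 0 s = profileDerivTwo q s := by simp [weightedDerivTwo]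
    rw [h2]
    simp only [Nat.cast_zero, mul_zero, pow_zero]
    nlinarith [mul_nonneg (sq_nonneg x) he]
  · have h := mul_le_mul_of_nonneg_left (weightedDerivTwo_succ_le hq hq' p hs) (sq_nonneg x)
    have h3 : x ^ 2 * s ^ p ≤ s ^ (p + 1) + x ^ (2 * (p + 1)) := by
      have hx := sq_nonneg x
      rw [pow_mul]
      rcases le_total (x ^ 2) s with h | h
      · have := mul_le_mul_of_nonneg_right h (pow_nonneg hs p)
        have h4 : 0 ≤ (x ^ 2) ^ (p + 1) := by positivity
        rw [pow_succ s]; linarith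
      · have := mul_le_mul_of_nonneg_left (pow_le_pow_left₀ hs h p) hx
        have h4 : 0 ≤ s ^ (p + 1) := by positivity
        rw [pow_succ (x ^ 2)]; linarith
    have h4 : s ^ (p + 1) + x ^ (2 * (p + 1))
        ≤ (1 + x ^ 2) * (s ^ (p + 1) + x ^ (2 * (p + 1))) := by
      have : 0 ≤ s ^ (p + 1) + x ^ (2 * (p + 1)) := by rw [pow_mul]; positivity
      nlinarith [mul_nonneg (sq_nonneg x) this]
    have h5 := mul_le_mul_of_nonneg_right (h3.trans h4) he
    push_cast
    calc _ ≤ _ := h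
      _ = (p + 1 + 1) ^ 2 * (x ^ 2 * s ^ p * expWeight q s) := by ring
      _ ≤ _ := mul_le_mul_of_nonneg_left h5 (by positivity)

end Profile

/-! ### Second order expansion of the Lyapunov function. -/

/-- Second order expansion with a one-sided remainder evaluated at an intermediate point. -/
theorem exists_le_add_mul_sq {g g' g'' : ℝ → ℝ} (hg : ∀ x, HasDerivAt g (g' x) x)
    (hg' : ∀ x, HasDerivAt g' (g'' x) x) (s t : ℝ) :
    ∃ u ∈ Set.uIcc s t, 0 ≤ g'' u → g t ≤ g s + g' s * (t - s) + g'' u * (t - s) ^ 2 := by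
  have hc : ∀ x y : ℝ, ContinuousOn g (Set.Icc x y) := fun x y z _ =>
    (hg z).continuousAt.continuousWithinAt
  have hc' : ∀ x y : ℝ, ContinuousOn g' (Set.Icc x y) := fun x y z _ =>
    (hg' z).continuousAt.continuousWithinAt
  rcases lt_trichotomy s t with h | h | h
  · obtain ⟨c, hc1, hc2⟩ := exists_hasDerivAt_eq_slope g g' h (hc _ _) (fun x _ => hg x)
    obtain ⟨u, hu1, hu2⟩ := exists_hasDerivAt_eq_slope g' g'' hc1.1 (hc' _ _) (fun x _ => hg' x)
    refine ⟨u, by rw [Set.uIcc_of_le h.le]; exact ⟨hu1.1.le, (hu1.2.trans hc1.2).le⟩, fun hu => ?_⟩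
    -- Two mean value steps replace Taylor's formula; bounding `c - s` by `t - s` loses only the
    -- factor `1/2`.
    rw [eq_div_iff (by linarith)] at hc2
    rw [eq_div_iff (by linarith [hc1.1])] at hu2
    have h1 : g'' u * (c - s) ≤ g'' u * (t - s) :=
      mul_le_mul_of_nonneg_left (by linarith [hc1.2]) hu
    nlinarith
  · exact ⟨s, Set.left_mem_uIcc, fun _ => by subst h; simp⟩
  · obtain ⟨c, hc1, hc2⟩ := exists_hasDerivAt_eq_slope g g' h (hc _ _) (fun x _ => hg x)
    obtain ⟨u, hu1, hu2⟩ := exists_hasDerivAt_eq_slope g' g'' hc1.2 (hc' _ _) (fun x _ => hg' x)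
    refine ⟨u, by rw [Set.uIcc_of_ge h.le]; exact ⟨(hc1.1.trans hu1.1).le, hu1.2.le⟩, fun hu => ?_⟩
    rw [eq_div_iff (by linarith)] at hc2
    rw [eq_div_iff (by linarith [hc1.2])] at hu2
    have h1 : g'' u * (s - c) ≤ g'' u * (s - t) :=
      mul_le_mul_of_nonneg_left (by linarith [hc1.1]) hu
    nlinarith

/-- This is the Taylor remainder: `v ^ 2` is the intermediate point, and the second factor bounds
the squared increment of `‖y‖ ^ 2`. The constant `26` is `8 + 18`, one share for each of the two
bounds on the second derivative. -/
theorem weightedDerivTwo_mul_le {q : ℝ} (hq : 0 < q) (hq' : q ≤ 1 / 2) (p : ℕ) {r η v : ℝ}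
    (hr0 : 0 ≤ r) (hη0 : 0 ≤ η) (hv0 : 0 ≤ v) (hv1 : v ≤ r + η) :
    weightedDerivTwo q p (v ^ 2) * (η ^ 2 * (8 * v ^ 2 + 18 * η ^ 2)) ≤
      26 * (p + 1) ^ 2 * (4 ^ p + 1) * (η ^ 2 * (1 + η ^ 2) *
        ((r ^ 2) ^ p + η ^ (2 * p)) * (expWeight q (r ^ 2) * expWeight q (η ^ 2))) := by
  have hG1 := mul_weightedDerivTwo_le hq hq' p (sq_nonneg v)
  have hG2 := sq_mul_weightedDerivTwo_le hq hq' p (x := η) (sq_nonneg v)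
  have heu0 := (expWeight_pos (q := q) (v ^ 2)).le
  have heu : expWeight q (v ^ 2) ≤ expWeight q (r ^ 2) * expWeight q (η ^ 2) :=
    le_trans (expWeight_mono hq hq' (sq_nonneg v) (pow_le_pow_left₀ hv0 hv1 2))
      (expWeight_add_sq_le hq hq' hr0 hη0)
  have hup : (v ^ 2) ^ p ≤ 4 ^ p * ((r ^ 2) ^ p + η ^ (2 * p)) := by
    rw [← pow_mul, ← pow_mul]
    -- `v / 2` is at most the larger of `r` and `η`.
    have hm : (v / 2) ^ (2 * p) ≤ r ^ (2 * p) + η ^ (2 * p) := by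
      have h1 : 0 ≤ r ^ (2 * p) := by positivity
      have h2 : 0 ≤ η ^ (2 * p) := by positivity
      have hz : 0 ≤ v / 2 := by positivity
      rcases le_total r η with h | h
      · have := pow_le_pow_left₀ hz (show v / 2 ≤ η by linarith) (2 * p); linarith
      · have := pow_le_pow_left₀ hz (show v / 2 ≤ r by linarith) (2 * p); linarith
    have h4 : (4 : ℝ) ^ p = 2 ^ (2 * p) := by rw [pow_mul]; norm_num
    rw [div_pow, div_le_iff₀ (by positivity)] at hm
    rw [h4]
    linarith
  have hSη : η ^ (2 * p) ≤ (r ^ 2) ^ p + η ^ (2 * p) := by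
    have : 0 ≤ (r ^ 2) ^ p := by positivity
    linarith
  have hS0 : 0 ≤ (r ^ 2) ^ p + η ^ (2 * p) := by positivity
  have he0 : 0 ≤ expWeight q (r ^ 2) * expWeight q (η ^ 2) :=
    mul_nonneg (expWeight_pos _).le (expWeight_pos _).le
  generalize (r ^ 2) ^ p + η ^ (2 * p) = S at *
  generalize expWeight q (r ^ 2) * expWeight q (η ^ 2) = e at *
  have hA : (v ^ 2) ^ p * expWeight q (v ^ 2) ≤ (1 + η ^ 2) * ((4 ^ p + 1) * S) * e := by
    refine mul_le_mul (hup.trans ?_) heu heu0 (by positivity)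
    have : 0 ≤ (4 ^ p + 1) * S := by positivity
    nlinarith [mul_nonneg (sq_nonneg η) this]
  have hB : (1 + η ^ 2) * ((v ^ 2) ^ p + η ^ (2 * p)) * expWeight q (v ^ 2)
      ≤ (1 + η ^ 2) * ((4 ^ p + 1) * S) * e := by
    refine mul_le_mul (mul_le_mul_of_nonneg_left ?_ (by positivity)) heu heu0 (by positivity)
    linarith
  have hp1 : (0 : ℝ) ≤ (p + 1) ^ 2 := by positivity
  have hA' := mul_le_mul_of_nonneg_left hA hp1
  have hB' := mul_le_mul_of_nonneg_left hB hp1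
  calc weightedDerivTwo q p (v ^ 2) * (η ^ 2 * (8 * v ^ 2 + 18 * η ^ 2))
      = η ^ 2 * (8 * (v ^ 2 * weightedDerivTwo q p (v ^ 2))
          + 18 * (η ^ 2 * weightedDerivTwo q p (v ^ 2))) := by ring
    _ ≤ η ^ 2 * (26 * ((p + 1) ^ 2 * ((1 + η ^ 2) * ((4 ^ p + 1) * S) * e))) := by
        refine mul_le_mul_of_nonneg_left ?_ (sq_nonneg η)
        linarith
    _ = _ := by ring

/-- The increment of `‖y‖ ^ 2` contains `‖h‖ ^ 2` besides the linear term. Its product with the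
first derivative fits the same bound as the Taylor remainder, and `2 + 26 = 28`. -/
theorem weightedDeriv_mul_sq_le {q : ℝ} (hq : 0 < q) (hq' : q ≤ 1 / 2) (p : ℕ) {r η : ℝ}
    (hη0 : 0 ≤ η) :
    weightedDeriv q p (r ^ 2) * η ^ 2 ≤
      2 * (p + 1) ^ 2 * (4 ^ p + 1) * (η ^ 2 * (1 + η ^ 2) *
        ((r ^ 2) ^ p + η ^ (2 * p)) * (expWeight q (r ^ 2) * expWeight q (η ^ 2))) := by
  have h1 := weightedDeriv_le hq hq' p (sq_nonneg r)
  have hr2 : 0 ≤ (r ^ 2) ^ p := by positivity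
  have he := (expWeight_pos (q := q) (r ^ 2)).le
  have h2 : (r ^ 2) ^ p * expWeight q (r ^ 2) ≤ (1 + η ^ 2) *
        ((r ^ 2) ^ p + η ^ (2 * p)) * (expWeight q (r ^ 2) * expWeight q (η ^ 2)) := by
    refine mul_le_mul ?_ ?_ he (by positivity)
    · have : 0 ≤ η ^ (2 * p) := by positivity
      nlinarith [mul_nonneg (sq_nonneg η) hr2, mul_nonneg (sq_nonneg η) this]
    · exact le_mul_of_one_le_right he (one_le_expWeight hq hq' (sq_nonneg η))
  have h0 := (mul_nonneg hr2 he).trans h2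
  have h3 : (p + 1 : ℝ) ≤ 2 * (p + 1) ^ 2 * (4 ^ p + 1) := by
    have hp : (1 : ℝ) ≤ p + 1 := by
      have : (0 : ℝ) ≤ p := Nat.cast_nonneg p
      linarith
    have h4 : (1 : ℝ) ≤ 4 ^ p + 1 := by
      have : (0 : ℝ) < 4 ^ p := by positivity
      linarith
    calc (p + 1 : ℝ) ≤ (p + 1) ^ 2 := by nlinarith
      _ ≤ 2 * (p + 1) ^ 2 * 1 := by nlinarith
      _ ≤ _ := mul_le_mul_of_nonneg_left h4 (by positivity)
  calc _ ≤ _ := mul_le_mul_of_nonneg_right (h1.trans (mul_le_mul_of_nonneg_left h2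
        (by positivity))) (sq_nonneg η)
    _ ≤ _ := mul_le_mul_of_nonneg_right (mul_le_mul_of_nonneg_right h3 h0) (sq_nonneg η)
    _ = _ := by ring

/-- Second order expansion of the Lyapunov profile along a step `y ↦ y - h`. -/
theorem weighted_profile_sub_le {E : Type*} [NormedAddCommGroup E] [InnerProductSpace ℝ E]
    {q : ℝ} (hq : 0 < q) (hq' : q ≤ 1 / 2) (p : ℕ) (y h : E) :
    (‖y - h‖ ^ 2) ^ p * profile q (‖y - h‖ ^ 2) ≤
      (‖y‖ ^ 2) ^ p * profile q (‖y‖ ^ 2)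
        - 2 * weightedDeriv q p (‖y‖ ^ 2) * inner ℝ y h
        + 28 * (p + 1) ^ 2 * (4 ^ p + 1) * (‖h‖ ^ 2 * (1 + ‖h‖ ^ 2) *
          ((‖y‖ ^ 2) ^ p + ‖h‖ ^ (2 * p)) * (expWeight q (‖y‖ ^ 2) * expWeight q (‖h‖ ^ 2))) := by
  have hyh : ‖y - h‖ ^ 2 - ‖y‖ ^ 2 = - 2 * inner ℝ y h + ‖h‖ ^ 2 := by
    rw [norm_sub_sq_real]; ring
  have hin : |inner ℝ y h| ≤ ‖y‖ * ‖h‖ := abs_real_inner_le_norm y h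
  obtain ⟨u, hu, hT⟩ := exists_le_add_mul_sq (hasDerivAt_weighted hq hq' p)
    (hasDerivAt_weightedDeriv hq hq' p) (‖y‖ ^ 2) (‖y - h‖ ^ 2)
  set η := ‖h‖ with hη
  set r := ‖y‖ with hr
  have hη0 : 0 ≤ η := norm_nonneg h
  have hr0 : 0 ≤ r := norm_nonneg y
  have hu0 : 0 ≤ u := by
    rcases Set.mem_uIcc.1 hu with h | h <;> exact (sq_nonneg _).trans h.1
  have hn1 : ‖y - h‖ ≤ r + η := norm_sub_le y h
  have hn2 : r ≤ ‖y - h‖ + η := by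
    have := norm_add_le (y - h) h
    rwa [sub_add_cancel] at this
  have hn0 := norm_nonneg (y - h)
  obtain ⟨v, hv0, hv⟩ : ∃ v : ℝ, 0 ≤ v ∧ u = v ^ 2 := ⟨√u, Real.sqrt_nonneg u, (Real.sq_sqrt hu0).symm⟩
  have hv1 : v ≤ r + η := by
    refine abs_le_of_sq_le_sq' ?_ (by positivity) |>.2
    rw [← hv]
    rcases Set.mem_uIcc.1 hu with h | h <;> nlinarith
  have hv2 : r ≤ v + η := by
    rcases Set.mem_uIcc.1 hu with hm | hm
    · have : r ≤ v := (abs_le_of_sq_le_sq' (by rw [← hv]; exact hm.1) hv0).2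
      linarith
    · have : ‖y - h‖ ≤ v := (abs_le_of_sq_le_sq' (by rw [← hv]; exact hm.1) hv0).2
      linarith
  -- The increment is at most `η (2 r + η) ≤ η (2 v + 3 η)`, and `(2 v + 3 η) ^ 2 ≤ 8 v ^ 2 + 18 η ^
  -- 2`.
  have hd : (‖y - h‖ ^ 2 - r ^ 2) ^ 2 ≤ η ^ 2 * (8 * u + 18 * η ^ 2) := by
    have h1 : |‖y - h‖ ^ 2 - r ^ 2| ≤ η * (2 * v + 3 * η) := by
      rw [hyh, abs_le]
      have := abs_le.1 hin
      constructor <;> nlinarith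
    have h2 : (‖y - h‖ ^ 2 - r ^ 2) ^ 2 ≤ (η * (2 * v + 3 * η)) ^ 2 :=
      sq_le_sq' (abs_le.1 h1).1 (abs_le.1 h1).2
    refine h2.trans ?_
    rw [hv, mul_pow]
    exact mul_le_mul_of_nonneg_left (by nlinarith [sq_nonneg (2 * v - 3 * η)]) (sq_nonneg η)
  have hG0 := weightedDerivTwo_nonneg hq hq' p hu0
  have hrem := (mul_le_mul_of_nonneg_left hd hG0).trans
    (hv ▸ weightedDerivTwo_mul_le hq hq' p hr0 hη0 hv0 hv1)
  have hlin := weightedDeriv_mul_sq_le hq hq' p (r := r) hη0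
  refine (hT hG0).trans ?_
  generalize η ^ 2 * (1 + η ^ 2) * ((r ^ 2) ^ p + η ^ (2 * p)) *
    (expWeight q (r ^ 2) * expWeight q (η ^ 2)) = R at *
  generalize (‖y - h‖ ^ 2 - r ^ 2) ^ 2 = Q at *
  rw [hyh, mul_add]
  linarith

/-! ### Contraction by the deterministic gradient step. -/

theorem exp_neg_le_one_sub {z : ℝ} (hz : 0 ≤ z) (hz' : z ≤ 1 / 6) :
    exp (-z) ≤ 1 - 5 / 6 * z := by
  have h := Real.abs_exp_sub_one_sub_id_le (x := -z) (by rw [abs_neg, abs_of_nonneg hz]; linarith)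
  have := (abs_le.1 h).2
  nlinarith

theorem weighted_profile_contraction_inside {q : ℝ} (p : ℕ) {s σ x : ℝ} (hσ : 0 ≤ σ) (hs : 0 ≤ s)
    (hs1 : s ≤ 1) (hx : 0 ≤ x) (hx' : (p + 1) * x ≤ 1 / 6) (h : σ ≤ s * (1 - x)) :
    σ ^ p * profile q σ ≤ (1 - 5 / 6 * ((p + 1) * x)) * (s ^ p * profile q s) := by
  have hp : (0 : ℝ) ≤ p := Nat.cast_nonneg p
  have hx1 : x ≤ 1 := by nlinarith
  have hσs : σ ≤ s := by nlinarith
  rw [profile, if_pos (hσs.trans hs1), profile, if_pos hs1, ← pow_succ, ← pow_succ]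
  have h1 : (1 - x) ^ (p + 1) ≤ exp (-((p + 1) * x)) := by
    have := pow_le_pow_left₀ (by linarith) (Real.one_sub_le_exp_neg x) (p + 1)
    rw [← Real.exp_nat_mul] at this
    refine this.trans_eq (congrArg exp ?_)
    push_cast; ring
  calc σ ^ (p + 1) ≤ (s * (1 - x)) ^ (p + 1) := pow_le_pow_left₀ hσ h _
    _ = (1 - x) ^ (p + 1) * s ^ (p + 1) := by rw [mul_pow, mul_comm]
    _ ≤ _ := mul_le_mul_of_nonneg_right
      (h1.trans (exp_neg_le_one_sub (by positivity) hx')) (by positivity)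

/-- If the step stays outside, Bernoulli's inequality gives `σ ^ q ≤ s ^ q - q τ`, so the exponent
drops by `(1 - q) τ`. If it enters the ball, the lower bound `h'` forces `s` to be close to `1`,
where the relative decrease of `s` itself is large enough. -/
theorem profile_contraction_outside {q : ℝ} (hq : 0 < q) (hq' : q ≤ 1 / 2) {s σ τ l : ℝ}
    (hσ : 0 ≤ σ) (hs : 1 < s) (hτ : 0 ≤ τ) (hτ' : (1 - q) * τ ≤ 1 / 6) (hl' : l ≤ 1 / 10)
    (h : σ ≤ s - τ * s ^ (1 - q)) (h' : s * (1 - l) ^ 2 ≤ σ) :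
    profile q σ ≤ (1 - 5 / 6 * ((1 - q) * τ)) * profile q s := by
  have hs0 : 0 < s := by linarith
  have hsq : 0 < s ^ q := Real.rpow_pos_of_pos hs0 q
  have hmul : s ^ q * s ^ (-q) = 1 := by
    rw [← Real.rpow_add hs0]; simp
  have hfac : s - τ * s ^ (1 - q) = s * (1 + -(τ * s ^ (-q))) := by
    rw [show (1 - q) = 1 + -q by ring, Real.rpow_add hs0, Real.rpow_one]; ring
  rw [hfac] at h
  -- Otherwise `h` would make `σ` negative; this is the range required by Bernoulli's inequality.
  have hge : -1 ≤ -(τ * s ^ (-q)) := by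
    by_contra hcon
    push Not at hcon
    nlinarith
  have hz0 : 0 ≤ (1 - q) * τ := mul_nonneg (by linarith) hτ
  have hE := exp_neg_le_one_sub hz0 hτ'
  have hps := profile_nonneg hq hq' hs0.le
  by_cases hσ1 : σ ≤ 1
  · rw [profile, if_pos hσ1]
    -- From `s (9/10) ^ 2 ≤ 1` and `q ≤ 1/2`. The resulting loss `9/10 τ` exceeds `5/6 (1 - q) τ`.
    have hsq2 : s ^ q ≤ 10 / 9 := by
      have h0 : (9 / 10 : ℝ) ^ 2 ≤ (1 - l) ^ 2 := pow_le_pow_left₀ (by norm_num) (by linarith) 2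
      have h1 : s * (9 / 10) ^ 2 ≤ 1 :=
        (mul_le_mul_of_nonneg_left h0 hs0.le).trans (h'.trans hσ1)
      calc s ^ q ≤ s ^ (1 / 2 : ℝ) := Real.rpow_le_rpow_of_exponent_le hs.le hq'
        _ = √s := (Real.sqrt_eq_rpow s).symm
        _ ≤ 10 / 9 := Real.sqrt_le_iff.2 ⟨by norm_num, by linarith⟩
    have hsn : 9 / 10 ≤ s ^ (-q) := by
      have : 0 < s ^ (-q) := Real.rpow_pos_of_pos hs0 _
      nlinarith
    have h1 : σ ≤ s * (1 - 9 / 10 * τ) :=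
      h.trans (mul_le_mul_of_nonneg_left (by nlinarith) hs0.le)
    have h2 : s * (1 - 9 / 10 * τ) ≤ s * (1 - 5 / 6 * ((1 - q) * τ)) :=
      mul_le_mul_of_nonneg_left (by nlinarith) hs0.le
    have h3 := mul_le_mul_of_nonneg_right (le_profile hq hq' s)
      (show 0 ≤ 1 - 5 / 6 * ((1 - q) * τ) by linarith)
    linarith
  · have h1 : σ ^ q ≤ s ^ q - q * τ := by
      calc σ ^ q ≤ (s * (1 + -(τ * s ^ (-q)))) ^ q := Real.rpow_le_rpow hσ h hq.le
        _ = s ^ q * (1 + -(τ * s ^ (-q))) ^ q := Real.mul_rpow hs0.le (by linarith)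
        _ ≤ s ^ q * (1 + q * -(τ * s ^ (-q))) := mul_le_mul_of_nonneg_left
          (rpow_one_add_le_one_add_mul_self hge hq.le (by linarith)) hsq.le
        _ = s ^ q - q * τ * (s ^ q * s ^ (-q)) := by ring
        _ = _ := by rw [hmul, mul_one]
    have h2 : exp ((1 - q) / q * (σ ^ q - 1))
        ≤ exp (-((1 - q) * τ)) * exp ((1 - q) / q * (s ^ q - 1)) := by
      rw [← exp_add]
      refine exp_le_exp.2 ?_
      have := mul_le_mul_of_nonneg_left h1 (div_nonneg (show 0 ≤ 1 - q by linarith) hq.le)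
      have h3 : (1 - q) / q * (q * τ) = (1 - q) * τ := by field_simp
      nlinarith
    have h3 : profile q σ ≤ exp (-((1 - q) * τ)) * profile q s := by
      rw [profile, profile, if_neg hσ1, if_neg (not_le.2 hs), ← mul_div_assoc]
      refine div_le_div_of_nonneg_right ?_ (by linarith)
      have : exp (-((1 - q) * τ)) ≤ 1 := Real.exp_le_one_iff.2 (by linarith)
      nlinarith
    exact h3.trans (mul_le_mul_of_nonneg_right hE hps)

theorem gradient_eq_zero_of_forall_le {d : ℕ} {f : Rd d → ℝ} {θstar : Rd d}
    (hmin : ∀ θ, f θstar ≤ f θ) : gradient f θstar = 0 := by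
  have h : IsLocalMin f θstar := Filter.Eventually.of_forall hmin
  rw [gradient, h.fderiv_eq_zero, map_zero]

section Step

variable {E : Type*} [NormedAddCommGroup E] [InnerProductSpace ℝ E] {u g : E} {α Δ : ℝ}

theorem norm_sub_smul_sq (α : ℝ) (u g : E) :
    ‖u - α • g‖ ^ 2 = ‖u‖ ^ 2 - 2 * (α * inner ℝ u g) + α ^ 2 * ‖g‖ ^ 2 := by
  rw [norm_sub_sq_real, inner_smul_right, norm_smul, mul_pow, Real.norm_eq_abs, sq_abs]

/-- The inner product contributes `2 α μ`; for small `α` the term `α ^ 2 ‖g‖ ^ 2` gives back at most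
`α μ / 2`. -/
theorem step_sq_le_inside {L μ : ℝ} (hα : 0 ≤ α)
    (h1 : α * (2 * L ^ 2) ≤ μ) (hgL : ‖g‖ ≤ L * ‖u‖) (hin : μ * ‖u‖ ^ 2 ≤ inner ℝ u g) :
    (‖u - α • g‖ / Δ) ^ 2 ≤ (‖u‖ / Δ) ^ 2 * (1 - 3 / 2 * (α * μ)) := by
  have hg2 : ‖g‖ ^ 2 ≤ L ^ 2 * ‖u‖ ^ 2 := by
    rw [← mul_pow]; exact pow_le_pow_left₀ (norm_nonneg g) hgL 2
  rw [div_pow, div_pow, div_mul_eq_mul_div]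
  refine div_le_div_of_nonneg_right ?_ (sq_nonneg Δ)
  rw [norm_sub_smul_sq]
  have e1 := mul_le_mul_of_nonneg_left hin hα
  have e2 := mul_le_mul_of_nonneg_left hg2 (sq_nonneg α)
  have e3 := mul_le_mul_of_nonneg_right (mul_le_mul_of_nonneg_left h1 hα) (sq_nonneg ‖u‖)
  linarith

/-- The same trade-off: `‖u‖ ^ (2 (k - 1)) Δ ^ (2 - k) ≤ ‖u‖ ^ k` outside the ball, so the squared
gradient costs at most a quarter of the drift `2 α b ‖u‖ ^ k`. The last power is `(‖u‖ / Δ) ^ k`. -/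
theorem step_sq_le_outside {a b k : ℝ} (hΔ : 0 < Δ) (hk2 : k ≤ 2)
    (hα : 0 ≤ α) (h3 : α * (2 * a ^ 2) ≤ b * Δ ^ (2 - k)) (hu : Δ ≤ ‖u‖)
    (hg : ‖g‖ ≤ a * ‖u‖ ^ (k - 1)) (hin : b * ‖u‖ ^ k ≤ inner ℝ u g) :
    (‖u - α • g‖ / Δ) ^ 2 ≤ (‖u‖ / Δ) ^ 2
        - (3 / 2 * (α * (b / Δ ^ (2 - k)))) * ((‖u‖ / Δ) ^ 2) ^ (1 - (1 - k / 2)) := by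
  have hu0 : 0 < ‖u‖ := hΔ.trans_le hu
  have hg2 : ‖g‖ ^ 2 ≤ a ^ 2 * (‖u‖ ^ (k - 1)) ^ 2 := by
    rw [← mul_pow]; exact pow_le_pow_left₀ (norm_nonneg g) hg 2
  have hg3 : (‖u‖ ^ (k - 1)) ^ 2 * Δ ^ (2 - k) ≤ ‖u‖ ^ k := by
    have e1 : Δ ^ (2 - k) ≤ ‖u‖ ^ (2 - k) := Real.rpow_le_rpow hΔ.le hu (by linarith)
    calc (‖u‖ ^ (k - 1)) ^ 2 * Δ ^ (2 - k) ≤ (‖u‖ ^ (k - 1)) ^ 2 * ‖u‖ ^ (2 - k) :=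
          mul_le_mul_of_nonneg_left e1 (sq_nonneg _)
      _ = ‖u‖ ^ k := by
        rw [sq, ← Real.rpow_add hu0, ← Real.rpow_add hu0]; congr 1; ring
  have hsk : ((‖u‖ / Δ) ^ 2) ^ (1 - (1 - k / 2)) = ‖u‖ ^ k / Δ ^ k := by
    rw [← Real.div_rpow hu0.le hΔ.le, ← Real.rpow_natCast, ← Real.rpow_mul (by positivity)]
    congr 1; push_cast; ring
  have hDk : Δ ^ k * Δ ^ (2 - k) = Δ ^ 2 := by
    rw [← Real.rpow_add hΔ, ← Real.rpow_natCast]; congr 1; push_cast; ring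
  have hD : 0 < Δ ^ (2 - k) := Real.rpow_pos_of_pos hΔ _
  have hDk0 : 0 < Δ ^ k := Real.rpow_pos_of_pos hΔ k
  have hnum : ‖u - α • g‖ ^ 2 ≤ ‖u‖ ^ 2 - 3 / 2 * (α * b) * ‖u‖ ^ k := by
    rw [norm_sub_smul_sq]
    have e1 := mul_le_mul_of_nonneg_left hin hα
    have e2 := mul_le_mul_of_nonneg_left hg2 (sq_nonneg α)
    have hb : 0 ≤ b := by
      have : 0 ≤ b * Δ ^ (2 - k) := le_trans (by positivity) h3
      exact nonneg_of_mul_nonneg_left this hD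
    have e3 : α ^ 2 * (a ^ 2 * (‖u‖ ^ (k - 1)) ^ 2) ≤ 1 / 2 * (α * b) * ‖u‖ ^ k := by
      calc α ^ 2 * (a ^ 2 * (‖u‖ ^ (k - 1)) ^ 2)
          = 1 / 2 * α * (α * (2 * a ^ 2)) * (‖u‖ ^ (k - 1)) ^ 2 := by ring
        _ ≤ 1 / 2 * α * (b * Δ ^ (2 - k)) * (‖u‖ ^ (k - 1)) ^ 2 := by gcongr
        _ = 1 / 2 * (α * b) * ((‖u‖ ^ (k - 1)) ^ 2 * Δ ^ (2 - k)) := by ring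
        _ ≤ _ := mul_le_mul_of_nonneg_left hg3 (by positivity)
    linarith
  rw [hsk, div_pow, div_pow]
  have : ‖u‖ ^ 2 / Δ ^ 2 - 3 / 2 * (α * (b / Δ ^ (2 - k))) * (‖u‖ ^ k / Δ ^ k)
      = (‖u‖ ^ 2 - 3 / 2 * (α * b) * ‖u‖ ^ k) / Δ ^ 2 := by
    rw [← hDk]; field_simp
  rw [this]
  exact div_le_div_of_nonneg_right hnum (sq_nonneg Δ)

theorem le_step_sq {L : ℝ} (hΔ : 0 < Δ) (hα : 0 ≤ α) (hαL : α * L ≤ 1)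
    (hgL : ‖g‖ ≤ L * ‖u‖) :
    (‖u‖ / Δ) ^ 2 * (1 - α * L) ^ 2 ≤ (‖u - α • g‖ / Δ) ^ 2 := by
  rw [← mul_pow]
  refine pow_le_pow_left₀ (mul_nonneg (by positivity) (by linarith)) ?_ 2
  rw [div_mul_eq_mul_div]
  refine div_le_div_of_nonneg_right ?_ hΔ.le
  have e1 := norm_sub_norm_le u (α • g)
  rw [norm_smul, Real.norm_eq_abs, abs_of_nonneg hα] at e1
  have e2 := mul_le_mul_of_nonneg_left hgL hα
  linarith

end Step

/-- The deterministic gradient step contracts the Lyapunov function. -/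
theorem exists_gradient_step_contraction {d : ℕ} {f : Rd d → ℝ} {θstar : Rd d}
    {L μ a b Δ k : ℝ} (hmin : ∀ θ : Rd d, f θstar ≤ f θ) (hsmooth : SmoothObjective f L)
    (htail : SubquadraticTail f θstar μ a b Δ k) (p : ℕ) :
    ∃ α₁ : ℝ, 0 < α₁ ∧ ∀ α : ℝ, 0 < α → α ≤ α₁ → ∀ θ : Rd d,
      (‖θ - θstar - α • gradient f θ‖ / Δ) ^ 2 ≤ (‖θ - θstar‖ / Δ) ^ 2 ∧
      ((‖θ - θstar - α • gradient f θ‖ / Δ) ^ 2) ^ p *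
          profile (1 - k / 2) ((‖θ - θstar - α • gradient f θ‖ / Δ) ^ 2) ≤
        (1 - 5 / 4 * (α * rateTwo k b Δ μ p)) *
          (((‖θ - θstar‖ / Δ) ^ 2) ^ p * profile (1 - k / 2) ((‖θ - θstar‖ / Δ) ^ 2)) := by
  obtain ⟨hμ, ha, hb, hΔ, hk1, hk2, hsc, hgg, hgi⟩ := htail
  obtain ⟨hL, -, hlip⟩ := hsmooth
  have hg0 := gradient_eq_zero_of_forall_le hmin
  have hq : 0 < 1 - k / 2 := by linarith
  have hq' : 1 - k / 2 ≤ 1 / 2 := by linarith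
  have hD : 0 < Δ ^ (2 - k) := Real.rpow_pos_of_pos hΔ _
  have hp : (0 : ℝ) ≤ p := Nat.cast_nonneg p
  obtain ⟨B, hB⟩ : ∃ B, b / Δ ^ (2 - k) = B := ⟨_, rfl⟩
  have hB0 : 0 < B := by rw [← hB]; positivity
  have hrB : b * k / (2 * Δ ^ (2 - k)) = k / 2 * B := by rw [← hB]; field_simp
  -- The thresholds with `2 L ^ 2` and `2 a ^ 2` control the squared gradient, those with `9` keep
  -- the decay exponents below `1/6`, and the last gives `α L ≤ 1/10`. The factor in the conclusion
  -- is `5/4 = 5/6 * 3/2`.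
  refine ⟨min (min (μ / (2 * L ^ 2)) (1 / (9 * ((p + 1) * μ))))
    (min (min (b * Δ ^ (2 - k) / (2 * a ^ 2)) (1 / (9 * (k / 2 * B)))) (1 / (10 * L))),
    by positivity, fun α hα hα' θ => ?_⟩
  simp only [le_min_iff] at hα'
  obtain ⟨⟨h1, h2⟩, ⟨h3, h4⟩, h5⟩ := hα'
  rw [le_div_iff₀ (by positivity)] at h1 h2 h3 h4 h5
  have hgL : ‖gradient f θ‖ ≤ L * ‖θ - θstar‖ := by
    have := hlip θ θstar
    rwa [hg0, sub_zero] at this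
  have hrate1 : rateTwo k b Δ μ p ≤ k / 2 * B := by
    rw [← hrB]; exact min_le_left _ _
  have hrate2 : rateTwo k b Δ μ p ≤ μ * (1 + p) := min_le_right _ _
  replace hsc := fun h => hsc θ θstar h (by simpa using hΔ.le)
  rw [hg0, sub_zero] at hsc
  replace hgi := hgi θ
  replace hgg := hgg θ
  generalize rateTwo k b Δ μ p = ρ at *
  generalize gradient f θ = g at *
  generalize θ - θstar = u at *
  have hs0 : 0 ≤ (‖u‖ / Δ) ^ 2 := sq_nonneg _
  have hσ0 : 0 ≤ (‖u - α • g‖ / Δ) ^ 2 := sq_nonneg _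
  have hps := profile_nonneg hq hq' hs0
  by_cases hin : ‖u‖ ≤ Δ
  · have hs1 : (‖u‖ / Δ) ^ 2 ≤ 1 := by
      have : ‖u‖ / Δ ≤ 1 := (div_le_one hΔ).2 hin
      exact pow_le_one₀ (by positivity) this
    have hσ := step_sq_le_inside (Δ := Δ) hα.le h1 hgL (hsc hin)
    have hαμ : 0 < α * μ := by positivity
    refine ⟨hσ.trans (mul_le_of_le_one_right hs0 (by linarith)), ?_⟩
    refine (weighted_profile_contraction_inside p hσ0 hs0 hs1 (by positivity)
      (by linarith) hσ).trans (mul_le_mul_of_nonneg_right ?_ (mul_nonneg (pow_nonneg hs0 p) hps))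
    have := mul_le_mul_of_nonneg_left hrate2 hα.le
    linarith
  · rw [not_le] at hin
    have hs1 : 1 < (‖u‖ / Δ) ^ 2 := by
      have : 1 < ‖u‖ / Δ := (one_lt_div hΔ).2 hin
      exact one_lt_pow₀ this (by norm_num)
    have hσ := step_sq_le_outside hΔ hk2.le hα.le h3 hin.le (hgg hin) (hgi hin)
    rw [hB] at hσ
    have hαL : α * L ≤ 1 / 10 := by linarith
    have hlow := le_step_sq hΔ hα.le (by linarith) hgL
    have hαB : 0 < α * B := by positivity
    have hσs : (‖u - α • g‖ / Δ) ^ 2 ≤ (‖u‖ / Δ) ^ 2 := by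
      refine hσ.trans (sub_le_self _ ?_)
      positivity
    refine ⟨hσs, ?_⟩
    have hc := profile_contraction_outside hq hq' hσ0 hs1 (by positivity) (by linarith) hαL hσ hlow
    have hr := mul_le_mul_of_nonneg_left hrate1 hα.le
    have hc' : profile (1 - k / 2) ((‖u - α • g‖ / Δ) ^ 2) ≤
        (1 - 5 / 4 * (α * ρ)) * profile (1 - k / 2) ((‖u‖ / Δ) ^ 2) := by
      refine hc.trans (mul_le_mul_of_nonneg_right ?_ hps)
      linarith
    calc _ ≤ ((‖u‖ / Δ) ^ 2) ^ p * profile (1 - k / 2) ((‖u - α • g‖ / Δ) ^ 2) :=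
          mul_le_mul_of_nonneg_right (pow_le_pow_left₀ hσ0 hσs p) (profile_nonneg hq hq' hσ0)
      _ ≤ _ := mul_le_mul_of_nonneg_left hc' (pow_nonneg hs0 p)
      _ = _ := by ring

/-! ### Exponential moments of the noise and absorption into the drift. -/

/-- Sub-exponential tails bound the exponential moment of order one half. -/
theorem lintegral_exp_half_le {Ω : Type*} [MeasurableSpace Ω] (P : Measure Ω)
    [IsFiniteMeasure P] {Z : Ω → ℝ} (hZ : Measurable Z) (hZ0 : ∀ ω, 0 ≤ Z ω)
    (htail : ∀ t : ℝ, 0 ≤ t → P.real {ω | t ≤ Z ω} ≤ 2 * exp (-t)) :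
    ∫⁻ ω, ENNReal.ofReal (exp (Z ω / 2)) ∂P ≤
      ENNReal.ofReal (∑' n : ℕ, 2 * exp (1 / 2) * exp (-(1 / 2)) ^ n) := by
  have hsum : Summable fun n : ℕ => 2 * exp (1 / 2) * exp (-(1 / 2)) ^ n :=
    (summable_geometric_of_lt_one (exp_pos _).le (Real.exp_lt_one_iff.2 (by norm_num))).mul_left _
  have hms : ∀ n : ℕ, MeasurableSet {ω | (n : ℝ) ≤ Z ω} := fun n =>
    measurableSet_le measurable_const hZ
  calc ∫⁻ ω, ENNReal.ofReal (exp (Z ω / 2)) ∂P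
      ≤ ∫⁻ ω, ∑' n : ℕ, {ω | (n : ℝ) ≤ Z ω}.indicator
          (fun _ => ENNReal.ofReal (exp ((n + 1) / 2))) ω ∂P := by
        refine lintegral_mono fun ω => ?_
        -- The term with index `⌊Z ω⌋₊` alone dominates; after integration the tail `exp (-n)` beats
        -- the weight `exp ((n + 1) / 2)`.
        refine le_trans ?_ (ENNReal.le_tsum ⌊Z ω⌋₊)
        rw [Set.indicator_of_mem (by exact Nat.floor_le (hZ0 ω))]
        refine ENNReal.ofReal_le_ofReal (exp_le_exp.2 ?_)
        have := (Nat.lt_floor_add_one (Z ω)).le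
        linarith
    _ = ∑' n : ℕ, ENNReal.ofReal (exp ((n + 1) / 2)) * P {ω | (n : ℝ) ≤ Z ω} := by
        rw [lintegral_tsum fun n => (measurable_const.indicator (hms n)).aemeasurable]
        exact tsum_congr fun n => lintegral_indicator_const (hms n) _
    _ ≤ ∑' n : ℕ, ENNReal.ofReal (2 * exp (1 / 2) * exp (-(1 / 2)) ^ n) := by
        refine ENNReal.tsum_le_tsum fun n => ?_
        rw [← ofReal_measureReal, ← ENNReal.ofReal_mul (exp_pos _).le]
        refine ENNReal.ofReal_le_ofReal ?_
        refine (mul_le_mul_of_nonneg_left (htail n (Nat.cast_nonneg n)) (exp_pos _).le).trans_eq ?_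
        rw [← Real.exp_nat_mul, mul_left_comm, mul_assoc, ← exp_add, ← exp_add]
        congr 2
        ring
    _ = _ := (ENNReal.ofReal_tsum_of_nonneg (fun n => by positivity) hsum).symm

/-- Polynomials are dominated by stretched exponentials. -/
theorem exists_one_add_pow_le_exp_rpow {c β : ℝ} (hc : 0 < c) (hβ : 0 < β) (m : ℕ) :
    ∃ C : ℝ, 0 < C ∧ ∀ x : ℝ, 0 ≤ x → (1 + x) ^ m ≤ C * exp (c * x ^ β) := by
  obtain ⟨N, hN⟩ := exists_nat_ge (m / β)
  refine ⟨2 ^ m * (1 + N.factorial / c ^ N), by positivity, fun x hx => ?_⟩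
  have hxβ : 0 ≤ x ^ β := Real.rpow_nonneg hx β
  have he : 1 ≤ exp (c * x ^ β) := Real.one_le_exp (by positivity)
  have hF : 0 ≤ N.factorial / c ^ N := by positivity
  rw [mul_assoc]
  rcases le_total x 1 with h | h
  · refine mul_le_mul_of_nonneg_left (b := 1) ?_ (pow_nonneg (zero_le_two (α := ℝ)) m)
      |>.trans' ?_
    · nlinarith
    · rw [mul_one]; exact pow_le_pow_left₀ (by linarith) (by linarith) m
  · have h1 : x ^ m ≤ (x ^ β) ^ N := by
      rw [← Real.rpow_natCast, ← Real.rpow_natCast, ← Real.rpow_mul hx]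
      refine Real.rpow_le_rpow_of_exponent_le h ?_
      rw [div_le_iff₀ hβ] at hN
      linarith
    have h2 := Real.pow_div_factorial_le_exp (c * x ^ β) (by positivity) N
    have h3 : (x ^ β) ^ N ≤ N.factorial / c ^ N * exp (c * x ^ β) := by
      rw [mul_pow, div_le_iff₀ (by positivity)] at h2
      rw [div_mul_eq_mul_div, le_div_iff₀ (by positivity)]
      linarith
    calc (1 + x) ^ m ≤ (2 * x) ^ m := pow_le_pow_left₀ (by linarith) (by linarith) m
      _ = 2 ^ m * x ^ m := mul_pow _ _ _
      _ ≤ _ := mul_le_mul_of_nonneg_left (by nlinarith) (by positivity)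

/-- The second order term created by a noise of size `α * ζ`, for small `α`. -/
theorem exists_noise_term_le {q : ℝ} (hq : 0 < q) (hq' : q ≤ 1 / 2) (p : ℕ) {c : ℝ} (hc : 0 < c) :
    ∃ α₂ : ℝ, 0 < α₂ ∧ ∃ C : ℝ, 0 < C ∧ ∀ α : ℝ, 0 < α → α ≤ α₂ → ∀ ζ A : ℝ, 0 ≤ ζ → 0 ≤ A →
      (α * ζ) ^ 2 * (1 + (α * ζ) ^ 2) * (A + (α * ζ) ^ (2 * p)) * expWeight q ((α * ζ) ^ 2) ≤
        α ^ 2 * (A + α ^ (2 * p)) * (C * exp (c * ζ ^ (2 * q) / 2)) := by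
  -- The exponent `c / 2` is shared: `c / 4` pays for the polynomial factors, and `c / 4` for the
  -- weight of `α ζ` once `α` is small.
  obtain ⟨C, hC, hCle⟩ := exists_one_add_pow_le_exp_rpow (c := c / 4) (β := 2 * q)
    (by positivity) (by positivity) (2 * p + 4)
  have hκ : 0 < (1 - q) / q := div_pos (by linarith) hq
  refine ⟨min 1 ((c / 4 / ((1 - q) / q)) ^ (1 / (2 * q))),
    lt_min one_pos (Real.rpow_pos_of_pos (by positivity) _), 2 * C, by positivity,
    fun α hα hα' ζ A hζ hA => ?_⟩
  obtain ⟨hα1, hα2⟩ := le_min_iff.1 hα'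
  have h1 : (1 - q) / q * α ^ (2 * q) ≤ c / 4 := by
    have := Real.rpow_le_rpow hα.le hα2 (show 0 ≤ 2 * q by positivity)
    rw [← Real.rpow_mul (by positivity), one_div_mul_cancel (by positivity), Real.rpow_one,
      le_div_iff₀ hκ] at this
    linarith
  have hexp : expWeight q ((α * ζ) ^ 2) ≤ exp (c / 4 * ζ ^ (2 * q)) := by
    refine exp_le_exp.2 ?_
    have : ((α * ζ) ^ 2) ^ q = α ^ (2 * q) * ζ ^ (2 * q) := by
      rw [← Real.mul_rpow hα.le hζ, Real.rpow_mul (by positivity)]; norm_num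
    rw [this, ← mul_assoc]
    exact mul_le_mul_of_nonneg_right h1 (Real.rpow_nonneg hζ _)
  have hpoly : ζ ^ 2 * (1 + ζ ^ 2) * (1 + ζ ^ (2 * p)) ≤ 2 * (1 + ζ) ^ (2 * p + 4) := by
    have e1 : ζ ^ 2 ≤ (1 + ζ) ^ 2 := pow_le_pow_left₀ hζ (by linarith) 2
    have e2 : 1 + ζ ^ 2 ≤ (1 + ζ) ^ 2 := by nlinarith
    have e3 : 1 + ζ ^ (2 * p) ≤ 2 * (1 + ζ) ^ (2 * p) := by
      have := pow_le_pow_left₀ hζ (show ζ ≤ 1 + ζ by linarith) (2 * p)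
      have := one_le_pow₀ (show 1 ≤ 1 + ζ by linarith) (n := 2 * p)
      linarith
    calc _ ≤ (1 + ζ) ^ 2 * (1 + ζ) ^ 2 * (2 * (1 + ζ) ^ (2 * p)) := by gcongr
      _ = _ := by ring
  have hαζ : (α * ζ) ^ 2 ≤ ζ ^ 2 := by
    refine pow_le_pow_left₀ (by positivity) ?_ 2
    nlinarith
  calc (α * ζ) ^ 2 * (1 + (α * ζ) ^ 2) * (A + (α * ζ) ^ (2 * p)) * expWeight q ((α * ζ) ^ 2)
      ≤ (α * ζ) ^ 2 * (1 + ζ ^ 2) * ((A + α ^ (2 * p)) * (1 + ζ ^ (2 * p))) *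
          exp (c / 4 * ζ ^ (2 * q)) := by
        have hz : 0 ≤ ζ ^ (2 * p) := by positivity
        have ha : 0 ≤ α ^ (2 * p) := by positivity
        refine mul_le_mul (mul_le_mul (mul_le_mul_of_nonneg_left (by linarith) (sq_nonneg _)) ?_
          (by positivity) (by positivity)) hexp (expWeight_pos _).le (by positivity)
        rw [mul_pow]
        nlinarith [mul_nonneg hA hz]
    _ = α ^ 2 * (A + α ^ (2 * p)) * ((ζ ^ 2 * (1 + ζ ^ 2) * (1 + ζ ^ (2 * p))) *
          exp (c / 4 * ζ ^ (2 * q))) := by ring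
    _ ≤ α ^ 2 * (A + α ^ (2 * p)) * ((2 * (C * exp (c / 4 * ζ ^ (2 * q)))) *
          exp (c / 4 * ζ ^ (2 * q))) := by
        have := hpoly.trans (mul_le_mul_of_nonneg_left (hCle ζ hζ) zero_le_two)
        gcongr
    _ = _ := by
        have : exp (c * ζ ^ (2 * q) / 2) = exp (c / 4 * ζ ^ (2 * q)) * exp (c / 4 * ζ ^ (2 * q)) := by
          rw [← exp_add]; ring_nf
        rw [this]; ring

/-- The noise contribution is absorbed by a fraction of the drift, up to a term of higher order. -/
theorem exists_absorb {q : ℝ} (hq : 0 < q) (hq' : q ≤ 1 / 2) (p : ℕ) {T ε : ℝ} (hT : 0 ≤ T)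
    (hε : 0 < ε) :
    ∃ α₃ : ℝ, 0 < α₃ ∧ ∃ D : ℝ, 0 ≤ D ∧ ∀ α : ℝ, 0 < α → α ≤ α₃ → ∀ s : ℝ, 0 ≤ s →
      T * α * (s ^ p + α ^ (2 * p)) * expWeight q s ≤
        ε * (s ^ p * profile q s) + D * α ^ (p + 1) := by
  set T' := T * exp ((1 - q) / q) with hT'
  have hT0 : 0 ≤ T' := by positivity
  refine ⟨min 1 (ε / (2 * T' + 1)), by positivity, T' * (T' / ε) ^ p + T', by positivity,
    fun α hα hα' s hs => ?_⟩
  obtain ⟨hα1, hα2⟩ := le_min_iff.1 hα'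
  rw [le_div_iff₀ (by positivity)] at hα2
  rcases le_or_gt s 1 with h | h
  · have he : expWeight q s ≤ exp ((1 - q) / q) := by
      have := expWeight_mono hq hq' hs h
      rwa [expWeight, expWeight, Real.one_rpow, mul_one] at this
    -- Either `T' α ≤ ε s` and the drift absorbs the term, or `s ≤ (T' / ε) α` and it is of order `α
    -- ^ (p + 1)`.
    have hY : T' * α * s ^ p ≤ ε * s ^ (p + 1) + T' * (T' / ε) ^ p * α ^ (p + 1) := by
      rcases le_total (T' * α) (ε * s) with h1 | h1
      · have h2 := mul_le_mul_of_nonneg_right h1 (pow_nonneg hs p)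
        have h3 : 0 ≤ T' * (T' / ε) ^ p * α ^ (p + 1) := by positivity
        rw [pow_succ]; linarith
      · have h2 : s ≤ T' / ε * α := by
          rw [div_mul_eq_mul_div, le_div_iff₀ hε]; linarith
        have h3 : 0 ≤ ε * s ^ (p + 1) := by positivity
        have h4 := mul_le_mul_of_nonneg_left (pow_le_pow_left₀ hs h2 p)
          (show 0 ≤ T' * α by positivity)
        rw [mul_pow] at h4
        rw [pow_succ α]; linarith
    have hα3 : α * α ^ (2 * p) ≤ α ^ (p + 1) := by
      rw [← pow_succ']
      exact pow_le_pow_of_le_one hα.le hα1 (by omega)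
    rw [profile, if_pos h, ← pow_succ]
    calc T * α * (s ^ p + α ^ (2 * p)) * expWeight q s
        ≤ T * α * (s ^ p + α ^ (2 * p)) * exp ((1 - q) / q) := by gcongr
      _ = T' * α * s ^ p + T' * (α * α ^ (2 * p)) := by rw [hT']; ring
      _ ≤ _ := by nlinarith
  · have he := expWeight_le_profile hq hq' h
    have hp0 := profile_nonneg hq hq' hs
    have h1 : α ^ (2 * p) ≤ s ^ p :=
      (pow_le_one₀ hα.le hα1).trans (one_le_pow₀ h.le)
    have hX : 0 ≤ s ^ p * profile q s := by positivity
    calc T * α * (s ^ p + α ^ (2 * p)) * expWeight q s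
        ≤ T * α * (s ^ p + s ^ p) * (exp ((1 - q) / q) * profile q s) :=
          mul_le_mul (mul_le_mul_of_nonneg_left (by linarith) (by positivity)) he
            (expWeight_pos s).le (by positivity)
      _ = (2 * T' * α) * (s ^ p * profile q s) := by rw [hT']; ring
      _ ≤ ε * (s ^ p * profile q s) := mul_le_mul_of_nonneg_right (by nlinarith) hX
      _ ≤ _ := le_add_of_nonneg_right (by positivity)

/-! ### The normalised Lyapunov function under a noisy step. -/

/-- The Lyapunov function `V_{k,2p}` normalised to equal `(‖u‖ / Δ) ^ (2 p + 2)` in the ball of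
radius `Δ`, with `k = 2 - 2 q`. -/
noncomputable def normalizedLyapunov {E : Type*} [Norm E] (q Δ : ℝ) (p : ℕ) (u : E) : ℝ :=
  ((‖u‖ / Δ) ^ 2) ^ p * profile q ((‖u‖ / Δ) ^ 2)

theorem normalizedLyapunov_nonneg {E : Type*} [Norm E] {q : ℝ} (hq : 0 < q) (hq' : q ≤ 1 / 2)
    (Δ : ℝ) (p : ℕ) (u : E) : 0 ≤ normalizedLyapunov q Δ p u :=
  mul_nonneg (pow_nonneg (sq_nonneg _) p) (profile_nonneg hq hq' (sq_nonneg _))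

theorem continuous_normalizedLyapunov {E : Type*} [SeminormedAddCommGroup E] {q : ℝ} (hq : 0 < q)
    (hq' : q ≤ 1 / 2) (Δ : ℝ) (p : ℕ) :
    Continuous (fun u : E => normalizedLyapunov q Δ p u) := by
  have : Continuous (profile q) :=
    continuous_iff_continuousAt.2 fun x => (hasDerivAt_profile hq hq' x).continuousAt
  unfold normalizedLyapunov
  fun_prop

section Noise

variable {E : Type*} [NormedAddCommGroup E] [InnerProductSpace ℝ E]

/-- Pointwise bound for a noisy step. -/
theorem exists_normalizedLyapunov_sub_le {q : ℝ} (hq : 0 < q) (hq' : q ≤ 1 / 2) (p : ℕ)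
    {Δ K : ℝ} (hΔ : 0 < Δ) (hK : 0 < K) :
    ∃ α₂ : ℝ, 0 < α₂ ∧ ∃ C : ℝ, 0 < C ∧ ∀ α : ℝ, 0 < α → α ≤ α₂ → ∀ y : E,
      ∃ c : ℝ, ∀ w : E, normalizedLyapunov q Δ p (y - α • w) ≤
        normalizedLyapunov q Δ p y - c * inner ℝ y w
          + C * α ^ 2 * (((‖y‖ / Δ) ^ 2) ^ p + α ^ (2 * p)) * expWeight q ((‖y‖ / Δ) ^ 2)
            * exp (‖w‖ ^ (2 * q) / K ^ (2 * q) / 2) := by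
  obtain ⟨α₂, hα₂, C, hC, H⟩ := exists_noise_term_le hq hq' p
    (c := Δ ^ (2 * q) / K ^ (2 * q)) (by positivity)
  -- The coefficient of the linear term depends on `y` but not on `w`, so this term vanishes in
  -- expectation.
  refine ⟨α₂, hα₂, 28 * (p + 1) ^ 2 * (4 ^ p + 1) * C, by positivity, fun α hα hα' y =>
    ⟨2 * weightedDeriv q p ((‖y‖ / Δ) ^ 2) * (Δ⁻¹ * (Δ⁻¹ * α)), fun w => ?_⟩⟩
  have hn : ∀ v : E, ‖Δ⁻¹ • v‖ = ‖v‖ / Δ := fun v => by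
    rw [norm_smul, norm_inv, Real.norm_eq_abs, abs_of_pos hΔ, inv_mul_eq_div]
  have h1 := weighted_profile_sub_le hq hq' p (Δ⁻¹ • y) (Δ⁻¹ • (α • w))
  rw [← smul_sub, inner_smul_left, inner_smul_right, inner_smul_right, hn, hn, hn, norm_smul,
    Real.norm_eq_abs, abs_of_pos hα, mul_div_assoc] at h1
  have h2 := H α hα hα' (‖w‖ / Δ) (((‖y‖ / Δ) ^ 2) ^ p) (by positivity) (by positivity)
  have h3 : Δ ^ (2 * q) / K ^ (2 * q) * (‖w‖ / Δ) ^ (2 * q) = ‖w‖ ^ (2 * q) / K ^ (2 * q) := by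
    rw [Real.div_rpow (norm_nonneg w) hΔ.le]
    have : 0 < Δ ^ (2 * q) := by positivity
    field_simp
  rw [h3] at h2
  have he := (expWeight_pos (q := q) ((‖y‖ / Δ) ^ 2)).le
  have h4 := mul_le_mul_of_nonneg_left (mul_le_mul_of_nonneg_right h2 he)
    (show (0 : ℝ) ≤ 28 * (p + 1) ^ 2 * (4 ^ p + 1) by positivity)
  unfold normalizedLyapunov
  refine h1.trans ?_
  simp only [conj_trivial]
  refine add_le_add (le_of_eq (by ring)) ?_
  calc _ = 28 * (p + 1) ^ 2 * (4 ^ p + 1) * ((α * (‖w‖ / Δ)) ^ 2 * (1 + (α * (‖w‖ / Δ)) ^ 2) *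
        (((‖y‖ / Δ) ^ 2) ^ p + (α * (‖w‖ / Δ)) ^ (2 * p)) * expWeight q ((α * (‖w‖ / Δ)) ^ 2) *
        expWeight q ((‖y‖ / Δ) ^ 2)) := by ring
    _ ≤ _ := h4
    _ = _ := by ring

/-- Bound for the expectation of the Lyapunov function after a centred step with stretched
exponential tails. -/
theorem exists_lintegral_normalizedLyapunov_sub_le [CompleteSpace E] [MeasurableSpace E]
    [BorelSpace E] [SecondCountableTopology E] {Ω : Type*} [MeasurableSpace Ω] (P : Measure Ω)
    [IsProbabilityMeasure P] {q : ℝ} (hq : 0 < q) (hq' : q ≤ 1 / 2) (p : ℕ) {Δ K : ℝ}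
    (hΔ : 0 < Δ) :
    ∃ α₂ : ℝ, 0 < α₂ ∧ ∃ T : ℝ, 0 ≤ T ∧ ∀ α : ℝ, 0 < α → α ≤ α₂ → ∀ (y : E) (w : Ω → E),
      Measurable w → ∫ ω, w ω ∂P = 0 → OrliczTail P (2 * q) K (fun ω => ‖w ω‖) →
      ∫⁻ ω, ENNReal.ofReal (normalizedLyapunov q Δ p (y - α • w ω)) ∂P ≤
        ENNReal.ofReal (normalizedLyapunov q Δ p y
          + T * α ^ 2 * (((‖y‖ / Δ) ^ 2) ^ p + α ^ (2 * p)) * expWeight q ((‖y‖ / Δ) ^ 2)) := by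
  -- `OrliczTail` includes `0 < K`, so the other case is vacuous.
  by_cases hK : 0 < K
  swap
  · exact ⟨1, one_pos, 0, le_rfl, fun _ _ _ _ _ _ _ h => absurd h.1 hK⟩
  obtain ⟨α₂, hα₂, C, hC, H⟩ := exists_normalizedLyapunov_sub_le (E := E) hq hq' p hΔ hK
  obtain ⟨C', hC', H'⟩ := exists_one_add_pow_le_exp_rpow (c := 1 / K ^ (2 * q) / 2) (β := 2 * q)
    (by positivity) (by positivity) 1
  set M := ∑' n : ℕ, 2 * exp (1 / 2) * exp (-(1 / 2)) ^ n with hM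
  have hM0 : 0 ≤ M := tsum_nonneg fun n => by positivity
  refine ⟨α₂, hα₂, C * M, by positivity, fun α hα hα' y w hw hmean htail => ?_⟩
  have hKq : 0 < K ^ (2 * q) := by positivity
  have hZm : Measurable fun ω => ‖w ω‖ ^ (2 * q) / K ^ (2 * q) := by fun_prop
  have hexp := lintegral_exp_half_le P hZm (fun ω => by positivity) (fun t ht => by
    -- The substitution makes `‖w‖ ^ (2 q) / K ^ (2 q)` sub-exponential at level `t`.
    have h := htail.2 (K * t ^ (1 / (2 * q))) (by positivity)
    have e1 : (K * t ^ (1 / (2 * q))) ^ (2 * q) = K ^ (2 * q) * t := by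
      rw [Real.mul_rpow hK.le (by positivity), ← Real.rpow_mul ht,
        one_div_mul_cancel (by positivity), Real.rpow_one]
    rw [e1, mul_div_cancel_left₀ _ hKq.ne'] at h
    convert h using 3
    ext ω
    simp only [abs_norm]
    rw [le_div_iff₀ hKq, mul_comm t, ← e1]
    exact Real.rpow_le_rpow_iff (by positivity) (norm_nonneg _) (by positivity))
  have hint : Integrable (fun ω => exp (‖w ω‖ ^ (2 * q) / K ^ (2 * q) / 2)) P := by
    refine ⟨(hZm.div_const 2).exp.aestronglyMeasurable, ?_⟩
    rw [hasFiniteIntegral_iff_ofReal (Filter.Eventually.of_forall fun ω => (exp_pos _).le)]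
    exact hexp.trans_lt ENNReal.ofReal_lt_top
  have hintle : ∫ ω, exp (‖w ω‖ ^ (2 * q) / K ^ (2 * q) / 2) ∂P ≤ M := by
    rw [integral_eq_lintegral_of_nonneg_ae (Filter.Eventually.of_forall fun ω => (exp_pos _).le)
      hint.1]
    exact ENNReal.toReal_le_of_le_ofReal hM0 hexp
  have hwint : Integrable w P := by
    refine (hint.const_mul C').mono' hw.aestronglyMeasurable (Filter.Eventually.of_forall fun ω => ?_)
    have := H' ‖w ω‖ (norm_nonneg _)
    rw [pow_one] at this
    have e : 1 / K ^ (2 * q) / 2 * ‖w ω‖ ^ (2 * q) = ‖w ω‖ ^ (2 * q) / K ^ (2 * q) / 2 := by ring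
    rw [e] at this
    linarith
  obtain ⟨c, hc⟩ := H α hα hα' y
  set R := α ^ 2 * (((‖y‖ / Δ) ^ 2) ^ p + α ^ (2 * p)) * expWeight q ((‖y‖ / Δ) ^ 2) with hR
  have hR0 : 0 ≤ R := mul_nonneg (by positivity) (expWeight_pos _).le
  have hc' : ∀ ω, normalizedLyapunov q Δ p (y - α • w ω) ≤ normalizedLyapunov q Δ p y
      - c * inner ℝ y (w ω) + C * R * exp (‖w ω‖ ^ (2 * q) / K ^ (2 * q) / 2) := fun ω =>
    (hc (w ω)).trans_eq (by rw [hR]; ring)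
  have hi1 : Integrable (fun ω => normalizedLyapunov q Δ p y - c * inner ℝ y (w ω)) P :=
    (integrable_const _).sub ((hwint.const_inner y).const_mul c)
  have hi2 := hint.const_mul (C * R)
  calc ∫⁻ ω, ENNReal.ofReal (normalizedLyapunov q Δ p (y - α • w ω)) ∂P
      ≤ ∫⁻ ω, ENNReal.ofReal (normalizedLyapunov q Δ p y - c * inner ℝ y (w ω)
          + C * R * exp (‖w ω‖ ^ (2 * q) / K ^ (2 * q) / 2)) ∂P :=
        lintegral_mono fun ω => ENNReal.ofReal_le_ofReal (hc' ω)
    _ = ENNReal.ofReal (∫ ω, (normalizedLyapunov q Δ p y - c * inner ℝ y (w ω)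
          + C * R * exp (‖w ω‖ ^ (2 * q) / K ^ (2 * q) / 2)) ∂P) :=
        (ofReal_integral_eq_lintegral_ofReal (hi1.add hi2) (Filter.Eventually.of_forall fun ω =>
          (normalizedLyapunov_nonneg hq hq' Δ p _).trans (hc' ω))).symm
    _ ≤ _ := by
        refine ENNReal.ofReal_le_ofReal ?_
        rw [integral_add hi1 hi2, integral_sub (integrable_const _)
          ((hwint.const_inner y).const_mul c), integral_const_mul, integral_const_mul,
          integral_inner hwint, hmean, inner_zero_right, mul_zero, sub_zero, integral_const,
          probReal_univ, one_smul]
        have := mul_le_mul_of_nonneg_left hintle (mul_nonneg hC.le hR0)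
        have e : C * M * α ^ 2 * (((‖y‖ / Δ) ^ 2) ^ p + α ^ (2 * p)) *
            expWeight q ((‖y‖ / Δ) ^ 2) = C * R * M := by rw [hR]; ring
        rw [e]
        linarith

end Noise

/-- `V_{k,0}` is `(k / 2) exp (k / (2 - k))` times `profile`; this explains the prefactor in the
final estimate. -/
theorem two_mul_lyapunov_eq {d : ℕ} {k Δ : ℝ} (hk1 : 1 ≤ k) (hk2 : k < 2) (hΔ : 0 < Δ) (p : ℕ)
    (θstar θ : Rd d) :
    2 * Δ ^ 2 * lyapunov k Δ (2 * p) θstar θ / (k * exp (k / (2 - k))) =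
      Δ ^ (2 * p + 2) * normalizedLyapunov (1 - k / 2) Δ p (θ - θstar) := by
  have hk : 0 < k := by linarith
  have h2k : 2 - k ≠ 0 := by linarith
  have hκ : (1 - (1 - k / 2)) / (1 - k / 2) = k / (2 - k) := by
    have : 1 - k / 2 ≠ 0 := by linarith
    field_simp
    ring
  have he : 0 < exp (k / (2 - k)) := exp_pos _
  unfold lyapunov normalizedLyapunov lyapunovZero profile
  rw [hκ]
  have hr := norm_nonneg (θ - θstar)
  generalize ‖θ - θstar‖ = r at *
  have hpow : Δ ^ (2 * p + 2) * ((r / Δ) ^ 2) ^ p = Δ ^ 2 * r ^ (2 * p) := by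
    rw [← pow_mul, div_pow, pow_add]; field_simp
  have hiff : (r / Δ) ^ 2 ≤ 1 ↔ r ≤ Δ := by
    rw [sq_le_one_iff₀ (by positivity), div_le_one hΔ]
  by_cases h : r ≤ Δ
  · rw [if_pos h, if_pos (hiff.2 h), ← mul_assoc (Δ ^ (2 * p + 2)), hpow]
    field_simp
  · rw [if_neg h, if_neg (fun h' => h (hiff.1 h')), ← mul_assoc (Δ ^ (2 * p + 2)), hpow]
    have hs : ((r / Δ) ^ 2) ^ (1 - k / 2) = r ^ (2 - k) / Δ ^ (2 - k) := by
      rw [← Real.div_rpow hr hΔ.le, ← Real.rpow_natCast, ← Real.rpow_mul (by positivity)]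
      congr 1; push_cast; ring
    have hE : exp (k * r ^ (2 - k) / ((2 - k) * Δ ^ (2 - k))) =
        exp (k / (2 - k)) * exp (k / (2 - k) * (((r / Δ) ^ 2) ^ (1 - k / 2) - 1)) := by
      rw [hs, ← exp_add]
      congr 1
      have : Δ ^ (2 - k) ≠ 0 := (Real.rpow_pos_of_pos hΔ _).ne'
      field_simp
      ring
    rw [hE]
    have : 1 - (1 - k / 2) = k / 2 := by ring
    rw [this]
    field_simp

theorem pow_norm_le_normalizedLyapunov {E : Type*} [SeminormedAddCommGroup E] {q : ℝ} (hq : 0 < q)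
    (hq' : q ≤ 1 / 2) {Δ : ℝ} (hΔ : 0 < Δ) (p : ℕ) (u : E) :
    ‖u‖ ^ (2 * p + 2) ≤ Δ ^ (2 * p + 2) * normalizedLyapunov q Δ p u := by
  calc ‖u‖ ^ (2 * p + 2) = Δ ^ (2 * p + 2) * (((‖u‖ / Δ) ^ 2) ^ p * (‖u‖ / Δ) ^ 2) := by
        rw [← pow_mul, ← pow_add, div_pow]; field_simp
    _ ≤ _ := by
        unfold normalizedLyapunov
        gcongr
        exact le_profile hq hq' _

theorem rateTwo_pos {d : ℕ} {f : Rd d → ℝ} {θstar : Rd d} {μ a b Δ k : ℝ}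
    (htail : SubquadraticTail f θstar μ a b Δ k) (p : ℕ) : 0 < rateTwo k b Δ μ p := by
  obtain ⟨hμ, -, hb, hΔ, hk1, -⟩ := htail
  have hk : 0 < k := by linarith
  exact lt_min (by positivity) (by positivity)

/-! ### The one-step recursion. -/

/-- One step of SGD from a deterministic point contracts the Lyapunov function in mean, up to a
term of order `α ^ (p + 2)`. -/
theorem exists_sgd_step_le {d : ℕ} {Ω S : Type*} [MeasurableSpace Ω] [MeasurableSpace S]
    (P : Measure Ω) [IsProbabilityMeasure P] {f : Rd d → ℝ} {θstar : Rd d} {L μ a b Δ k K : ℝ}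
    {W : Rd d → S → Rd d} {ξ : ℕ → Ω → S} (hmin : ∀ θ : Rd d, f θstar ≤ f θ)
    (hsmooth : SmoothObjective f L) (htail : SubquadraticTail f θstar μ a b Δ k)
    (hnoise : IIDCenteredField P W ξ)
    (horlicz : ∀ θ : Rd d, OrliczTail P (2 - k) K (fun ω => ‖W θ (ξ 0 ω)‖)) (p : ℕ) :
    ∃ αbar : ℝ, 0 < αbar ∧ ∃ D : ℝ, 0 ≤ D ∧ ∀ α : ℝ, 0 < α → α ≤ αbar →
      α * rateTwo k b Δ μ p ≤ 1 ∧ ∀ θ : Rd d,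
      ∫⁻ ω, ENNReal.ofReal (normalizedLyapunov (1 - k / 2) Δ p
          (θ - α • (gradient f θ + W θ (ξ 0 ω)) - θstar)) ∂P ≤
        ENNReal.ofReal ((1 - α * rateTwo k b Δ μ p) *
          normalizedLyapunov (1 - k / 2) Δ p (θ - θstar) + D * α ^ (p + 2)) := by
  have hρ := rateTwo_pos htail p
  obtain ⟨α₁, hα₁, H₁⟩ := exists_gradient_step_contraction hmin hsmooth htail p
  obtain ⟨hμ, ha, hb, hΔ, hk1, hk2, -, -, -⟩ := htail
  have hq : 0 < 1 - k / 2 := by linarith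
  have hq' : 1 - k / 2 ≤ 1 / 2 := by linarith
  obtain ⟨α₂, hα₂, T, hT, H₂⟩ := exists_lintegral_normalizedLyapunov_sub_le (E := Rd d) P hq hq' p
    (K := K) hΔ
  generalize rateTwo k b Δ μ p = ρ at *
  -- A quarter of the rate is spent on noise, leaving `5/4 - 1/4 = 1`.
  obtain ⟨α₃, hα₃, D, hD, H₃⟩ := exists_absorb hq hq' p hT (show 0 < ρ / 4 by positivity)
  refine ⟨min (min α₁ α₂) (min α₃ (1 / ρ)), by positivity, D, hD, fun α hα hα' => ?_⟩
  simp only [le_min_iff] at hα'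
  obtain ⟨⟨h1, h2⟩, h3, h4⟩ := hα'
  rw [le_div_iff₀ hρ] at h4
  refine ⟨h4, fun θ => ?_⟩
  have hm : Measurable fun ω => W θ (ξ 0 ω) :=
    hnoise.measurable_field.comp (measurable_const.prodMk (hnoise.measurable_seed 0))
  have horl := horlicz θ
  rw [show 2 - k = 2 * (1 - k / 2) by ring] at horl
  have hint := H₂ α hα h2 (θ - θstar - α • gradient f θ) _ hm (hnoise.centered θ) horl
  obtain ⟨hσs, hdrift⟩ := H₁ α hα h1 θ
  have habs := mul_le_mul_of_nonneg_left
    (H₃ α hα h3 ((‖θ - θstar‖ / Δ) ^ 2) (sq_nonneg _)) hα.le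
  have hew := expWeight_mono hq hq' (sq_nonneg _) hσs
  have hpw := pow_le_pow_left₀ (sq_nonneg _) hσs p
  have hrw : ∀ ω, θ - α • (gradient f θ + W θ (ξ 0 ω)) - θstar =
      θ - θstar - α • gradient f θ - α • W θ (ξ 0 ω) := fun ω => by
    rw [smul_add]; abel
  simp only [hrw]
  refine hint.trans (ENNReal.ofReal_le_ofReal ?_)
  -- The noise acts after the gradient step; as that step does not increase the distance, the bound
  -- may be evaluated at `θ`.
  have hnoise_le : T * α ^ 2 * (((‖θ - θstar - α • gradient f θ‖ / Δ) ^ 2) ^ p + α ^ (2 * p)) *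
      expWeight (1 - k / 2) ((‖θ - θstar - α • gradient f θ‖ / Δ) ^ 2) ≤
      α * (T * α * (((‖θ - θstar‖ / Δ) ^ 2) ^ p + α ^ (2 * p)) *
        expWeight (1 - k / 2) ((‖θ - θstar‖ / Δ) ^ 2)) := by
    refine (mul_le_mul (mul_le_mul_of_nonneg_left (add_le_add_left hpw _) (by positivity)) hew
      (expWeight_pos _).le (by positivity)).trans_eq (by ring)
  have hp2 : α * (D * α ^ (p + 1)) = D * α ^ (p + 2) := by ring
  unfold normalizedLyapunov
  rw [mul_add α, hp2] at habs
  linarith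

/-! ### Independence and the Markov property of the iterates. -/

/-- The iterate after `n` steps depends only on the first `n` seeds. -/
theorem measurable_sgd {d : ℕ} {Ω S : Type*} [MeasurableSpace S] {f : Rd d → ℝ}
    {W : Rd d → S → Rd d} (ξ : ℕ → Ω → S)
    (hgrad : Measurable (gradient f)) (hW : Measurable (Function.uncurry W)) (α : ℝ) (θ₀ : Rd d)
    (n : ℕ) :
    Measurable[⨆ i ∈ Set.Iio n, MeasurableSpace.comap (ξ i) inferInstance]
      (sgd f W ξ α θ₀ n) := by
  induction n with
  | zero => exact measurable_const
  | succ n ih =>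
    have hle : (⨆ i ∈ Set.Iio n, MeasurableSpace.comap (ξ i) inferInstance) ≤
        ⨆ i ∈ Set.Iio (n + 1), MeasurableSpace.comap (ξ i) inferInstance :=
      biSup_mono fun i hi => lt_trans hi (Nat.lt_succ_self n)
    have h1 := ih.mono hle le_rfl
    have h2 : Measurable[⨆ i ∈ Set.Iio (n + 1), MeasurableSpace.comap (ξ i) inferInstance]
        (ξ n) :=
      (comap_measurable (ξ n)).mono
        (le_biSup (fun i => MeasurableSpace.comap (ξ i) inferInstance)
          (show n ∈ Set.Iio (n + 1) from Nat.lt_succ_self n)) le_rfl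
    have hG : Measurable fun z : Rd d × S => z.1 - α • (gradient f z.1 + W z.1 z.2) := by
      have h3 : Measurable fun z : Rd d × S => W z.1 z.2 := hW
      have h4 : Measurable fun z : Rd d × S => gradient f z.1 := hgrad.comp measurable_fst
      exact measurable_fst.sub ((h4.add h3).const_smul α)
    exact hG.comp (h1.prodMk h2)

section Chain

variable {d : ℕ} {Ω S : Type*} [MeasurableSpace Ω] [MeasurableSpace S]

theorem indepFun_sgd {P : Measure Ω} {f : Rd d → ℝ} {W : Rd d → S → Rd d} {ξ : ℕ → Ω → S}
    (hgrad : Measurable (gradient f)) (hW : Measurable (Function.uncurry W))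
    (hξ : ∀ n, Measurable (ξ n)) (hind : iIndepFun ξ P) (α : ℝ) (θ₀ : Rd d) (n : ℕ) :
    IndepFun (sgd f W ξ α θ₀ n) (ξ n) P := by
  have h := indep_iSup_of_disjoint (fun i => (hξ i).comap_le)
    ((iIndepFun_iff_iIndep _ ξ P).1 hind)
    (show Disjoint (Set.Iio n) {n} by simp)
  rw [IndepFun_iff_Indep]
  refine indep_of_indep_of_le_left (indep_of_indep_of_le_right h ?_)
    (measurable_sgd ξ hgrad hW α θ₀ n).comap_le
  simp

/-- The Markov property: the law of the next iterate is obtained by integrating over a fresh seed. -/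
theorem lintegral_sgd_succ {P : Measure Ω} [IsProbabilityMeasure P] {f : Rd d → ℝ}
    {W : Rd d → S → Rd d} {ξ : ℕ → Ω → S} (hgrad : Measurable (gradient f))
    (hnoise : IIDCenteredField P W ξ) (α : ℝ) (θ₀ : Rd d) (n : ℕ) {Φ : Rd d → ENNReal}
    (hΦ : Measurable Φ) :
    ∫⁻ ω, Φ (sgd f W ξ α θ₀ (n + 1) ω) ∂P =
      ∫⁻ ω, ∫⁻ ω', Φ (sgd f W ξ α θ₀ n ω - α • (gradient f (sgd f W ξ α θ₀ n ω)
        + W (sgd f W ξ α θ₀ n ω) (ξ 0 ω'))) ∂P ∂P := by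
  obtain ⟨hW, hξ, hind, hid, -⟩ := hnoise
  have hθ : Measurable (sgd f W ξ α θ₀ n) :=
    (measurable_sgd ξ hgrad hW α θ₀ n).mono (iSup₂_le fun i _ => (hξ i).comap_le) le_rfl
  have hG : Measurable fun z : Rd d × S => Φ (z.1 - α • (gradient f z.1 + W z.1 z.2)) := by
    have h3 : Measurable fun z : Rd d × S => W z.1 z.2 := hW
    have h4 : Measurable fun z : Rd d × S => gradient f z.1 := hgrad.comp measurable_fst
    exact hΦ.comp (measurable_fst.sub ((h4.add h3).const_smul α))
  -- By independence the joint law is a product, so Tonelli applies; equality in law then replaces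
  -- `ξ n` by `ξ 0`.
  have hprod := (indepFun_iff_map_prod_eq_prod_map_map hθ.aemeasurable (hξ n).aemeasurable).1
    (indepFun_sgd hgrad hW hξ hind α θ₀ n)
  calc ∫⁻ ω, Φ (sgd f W ξ α θ₀ (n + 1) ω) ∂P
      = ∫⁻ z, Φ (z.1 - α • (gradient f z.1 + W z.1 z.2))
          ∂(P.map fun ω => (sgd f W ξ α θ₀ n ω, ξ n ω)) :=
        (lintegral_map hG (hθ.prodMk (hξ n))).symm
    _ = ∫⁻ x, ∫⁻ z, Φ (x - α • (gradient f x + W x z)) ∂(P.map (ξ 0))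
          ∂(P.map (sgd f W ξ α θ₀ n)) := by
        have : IsProbabilityMeasure (P.map (ξ 0)) :=
          Measure.isProbabilityMeasure_map (hξ 0).aemeasurable
        rw [hprod, (hid n).map_eq, lintegral_prod _ hG.aemeasurable]
    _ = ∫⁻ x, ∫⁻ ω', Φ (x - α • (gradient f x + W x (ξ 0 ω'))) ∂P
          ∂(P.map (sgd f W ξ α θ₀ n)) :=
        lintegral_congr fun x => lintegral_map (hG.comp measurable_prodMk_left) (hξ 0)
    _ = _ := by
        refine lintegral_map (Measurable.lintegral_prod_right' (f := fun z : Rd d × Ω =>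
          Φ (z.1 - α • (gradient f z.1 + W z.1 (ξ 0 z.2)))) ?_) hθ
        exact hG.comp (measurable_fst.prodMk ((hξ 0).comp measurable_snd))

end Chain

/-! ### Iteration of the recursion and the moment bound. -/

theorem mainTheorem2 {d : ℕ} {Ω S : Type*} [MeasurableSpace Ω] [MeasurableSpace S]
    (P : MeasureTheory.Measure Ω) [MeasureTheory.IsProbabilityMeasure P]
    (f : Rd d → ℝ) (θstar : Rd d) (L μ a b Δ k K : ℝ)
    (W : Rd d → S → Rd d) (ξ : ℕ → Ω → S)
    (hmin : ∀ θ : Rd d, f θstar ≤ f θ)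
    (hsmooth : SmoothObjective f L)
    (htail : SubquadraticTail f θstar μ a b Δ k)
    (hnoise : IIDCenteredField P W ξ)
    (horlicz : ∀ θ : Rd d, OrliczTail P (2 - k) K (fun ω => ‖W θ (ξ 0 ω)‖))
    (p : ℕ) :
    ∃ αbar : ℝ, 0 < αbar ∧ ∃ D : ℝ, ∀ (θ₀ : Rd d) (α : ℝ), 0 < α → α ≤ αbar →
      ∀ n : ℕ, -(p : ℝ) * Real.log α / (α * rateTwo k b Δ μ 0) ≤ (n : ℝ) →
        MeasureTheory.Integrable
            (fun ω => ‖sgd f W ξ α θ₀ n ω - θstar‖ ^ (2 * p + 2)) P ∧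
          ∫ ω, ‖sgd f W ξ α θ₀ n ω - θstar‖ ^ (2 * p + 2) ∂P ≤
            2 * Δ ^ 2 * lyapunov k Δ (2 * p) θstar θ₀ / (k * Real.exp (k / (2 - k))) *
                (1 - α * rateTwo k b Δ μ p) ^ n
              + α ^ (p + 1) * D := by
  obtain ⟨αbar, hαbar, D, hD, H⟩ := exists_sgd_step_le P hmin hsmooth htail hnoise horlicz p
  have hρ := rateTwo_pos htail p
  have hΔ := htail.Δ_pos
  have hk1 := htail.one_le_k
  have hk2 := htail.k_lt_two
  have hq : 0 < 1 - k / 2 := by linarith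
  have hq' : 1 - k / 2 ≤ 1 / 2 := by linarith
  have hgrad : Measurable (gradient f) := by
    have : LipschitzWith (Real.toNNReal L) (gradient f) :=
      LipschitzWith.of_dist_le_mul fun x y => by
        rw [dist_eq_norm, dist_eq_norm, Real.coe_toNNReal L hsmooth.L_pos.le]
        exact hsmooth.lipschitz_gradient x y
    exact this.continuous.measurable
  refine ⟨αbar, hαbar, Δ ^ (2 * p + 2) * (D / rateTwo k b Δ μ p), fun θ₀ α hα hα' n _ => ?_⟩
  obtain ⟨hαρ, hstep⟩ := H α hα hα'
  rw [two_mul_lyapunov_eq hk1 hk2 hΔ]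
  generalize rateTwo k b Δ μ p = ρ at *
  have hVn : ∀ u : Rd d, 0 ≤ normalizedLyapunov (1 - k / 2) Δ p u :=
    normalizedLyapunov_nonneg hq hq' Δ p
  have hΦ : Measurable fun θ : Rd d =>
      ENNReal.ofReal (normalizedLyapunov (1 - k / 2) Δ p (θ - θstar)) :=
    ((continuous_normalizedLyapunov hq hq' Δ p).comp
      (continuous_id.sub continuous_const)).measurable.ennreal_ofReal
  have hrem : 0 ≤ D * α ^ (p + 1) / ρ := by positivity
  have hθ : ∀ m, Measurable (sgd f W ξ α θ₀ m) := fun m =>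
    (measurable_sgd ξ hgrad hnoise.measurable_field α θ₀ m).mono
      (iSup₂_le fun i _ => (hnoise.measurable_seed i).comap_le) le_rfl
  have hΦθ : ∀ m, Measurable fun ω => ENNReal.ofReal
      (normalizedLyapunov (1 - k / 2) Δ p (sgd f W ξ α θ₀ m ω - θstar)) := fun m => hΦ.comp (hθ m)
  -- `D α ^ (p + 1) / ρ` is the fixed point of `x ↦ (1 - α ρ) x + D α ^ (p + 2)`. Working with `∫⁻`
  -- requires no integrability in advance; finiteness is a consequence.
  have hbound : ∀ m : ℕ, ∫⁻ ω, ENNReal.ofReal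
      (normalizedLyapunov (1 - k / 2) Δ p (sgd f W ξ α θ₀ m ω - θstar)) ∂P ≤
      ENNReal.ofReal ((1 - α * ρ) ^ m * normalizedLyapunov (1 - k / 2) Δ p (θ₀ - θstar)
        + D * α ^ (p + 1) / ρ) := by
    intro m
    induction m with
    | zero =>
      simp only [sgd, lintegral_const, measure_univ, mul_one, pow_zero, one_mul]
      exact ENNReal.ofReal_le_ofReal (le_add_of_nonneg_right hrem)
    | succ m ih =>
      rw [lintegral_sgd_succ hgrad hnoise α θ₀ m hΦ]
      have hr : 0 ≤ 1 - α * ρ := by linarith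
      have hV0 := hVn (θ₀ - θstar)
      calc _ ≤ ∫⁻ ω, (ENNReal.ofReal (1 - α * ρ) * ENNReal.ofReal
              (normalizedLyapunov (1 - k / 2) Δ p (sgd f W ξ α θ₀ m ω - θstar))
              + ENNReal.ofReal (D * α ^ (p + 2))) ∂P := by
            refine lintegral_mono fun ω => (hstep _).trans_eq ?_
            rw [ENNReal.ofReal_add (mul_nonneg hr (hVn _)) (by positivity), ENNReal.ofReal_mul hr]
        _ = ENNReal.ofReal (1 - α * ρ) * ∫⁻ ω, ENNReal.ofReal
              (normalizedLyapunov (1 - k / 2) Δ p (sgd f W ξ α θ₀ m ω - θstar)) ∂P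
              + ENNReal.ofReal (D * α ^ (p + 2)) := by
            rw [lintegral_add_right _ measurable_const, lintegral_const, measure_univ, mul_one,
              lintegral_const_mul _ (hΦθ m)]
        _ ≤ ENNReal.ofReal (1 - α * ρ) * ENNReal.ofReal ((1 - α * ρ) ^ m *
              normalizedLyapunov (1 - k / 2) Δ p (θ₀ - θstar) + D * α ^ (p + 1) / ρ)
              + ENNReal.ofReal (D * α ^ (p + 2)) := by gcongr
        _ = _ := by
            rw [← ENNReal.ofReal_mul hr, ← ENNReal.ofReal_add (by positivity) (by positivity)]
            congr 1
            field_simp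
            ring
  have hpow : ∫⁻ ω, ENNReal.ofReal (‖sgd f W ξ α θ₀ n ω - θstar‖ ^ (2 * p + 2)) ∂P ≤
      ENNReal.ofReal (Δ ^ (2 * p + 2) * ((1 - α * ρ) ^ n *
        normalizedLyapunov (1 - k / 2) Δ p (θ₀ - θstar) + D * α ^ (p + 1) / ρ)) := by
    rw [ENNReal.ofReal_mul (by positivity)]
    refine le_trans ?_ (mul_le_mul_right (hbound n) _)
    rw [← lintegral_const_mul _ (hΦθ n)]
    refine lintegral_mono fun ω => ?_
    rw [← ENNReal.ofReal_mul (by positivity)]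
    exact ENNReal.ofReal_le_ofReal (pow_norm_le_normalizedLyapunov hq hq' hΔ p _)
  have hmeas : AEStronglyMeasurable
      (fun ω => ‖sgd f W ξ α θ₀ n ω - θstar‖ ^ (2 * p + 2)) P :=
    (((hθ n).sub_const θstar).norm.pow_const _).aestronglyMeasurable
  have hnn : 0 ≤ᵐ[P] fun ω => ‖sgd f W ξ α θ₀ n ω - θstar‖ ^ (2 * p + 2) :=
    Filter.Eventually.of_forall fun ω => by positivity
  refine ⟨⟨hmeas, ?_⟩, ?_⟩
  · rw [hasFiniteIntegral_iff_ofReal hnn]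
    exact hpow.trans_lt ENNReal.ofReal_lt_top
  · rw [integral_eq_lintegral_of_nonneg_ae hnn hmeas]
    have hr : 0 ≤ 1 - α * ρ := by linarith
    have hV0 := hVn (θ₀ - θstar)
    refine (ENNReal.toReal_le_of_le_ofReal (by positivity) hpow).trans_eq ?_
    ring
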